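/- Let $d\ge 0$ be an integer, $X=\mathbb{R}^d$, and let $\mathscr{B}$ be the algebra of bounded operators on $L^2(X)$. For $a\in X$ let $(e^{iaq}u)(x)=e^{ia\cdot x}u(x)$ and $(e^{iap}u)(x)=u(x+a)$, and set $\tau_a(A)=e^{iap}Ae^{-iap}$ for $A\in\mathscr{B}$. The elliptic algebra $\mathscr{E}$ is the set of all $A\in\mathscr{B}$ such that $$\lim_{a\to0}\|(e^{iap}-1)A\|=\lim_{a\to0}\|(e^{iap}-1)A^*\|=\lim_{a\to0}\|e^{-iaq}Ae^{iaq}-A\|=0 .$$ The local norm topology on $\mathscr{B}$ is the one defined by the seminorms $A\mapsto\|A\,\theta(q)\|$, where $\theta$ runs over the continuous functions $X\to\mathbb{C}$ that tend to zero at infinity and $\theta(q)$ is multiplication by $\theta$. Let $X^\dagger$ be the set of all ultrafilters on $X$ that contain the complement of every bounded subset of $X$. The spectrum of $A\in\mathscr{B}$ is denoted $\mathrm{Sp}(A)$, and its essential spectrum $\mathrm{Sp_{ess}}(A)$ is the set of $\lambda\in\mathbb{C}$ such that $A-\lambda$ is not a Fredholm operator. Theorem. Let $A\in\mathscr{E}$.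 For every $\varkappa\in X^\dagger$ the translates $\tau_x(A)$ have, as $x\to\varkappa$, a (unique) limit $A_\varkappa\in\mathscr{B}$ in the local norm topology, and $$\mathrm{Sp_{ess}}(A)=\bigcup_{\varkappa\in X^\dagger}\mathrm{Sp}(A_\varkappa).$$ -/

import Mathlib

open Filter Topology MeasureTheory
open scoped BoundedContinuousFunction ZeroAtInfty ENNReal

noncomputable section

namespace EllipticAlgebra

/-- The configuration space `X = ℝ^d`, with its Euclidean structure. -/
abbrev X (d : ℕ) : Type := EuclideanSpace ℝ (Fin d)

/-- The Hilbert space `L²(X)` of complex square integrable functions for Lebesgue measure. -/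
abbrev L2 (d : ℕ) : Type := Lp ℂ 2 (volume : Measure (X d))

/-- The algebra of bounded linear operators on `L²(X)`. Its standard norm is the operator norm. -/
abbrev BddOp (d : ℕ) : Type := L2 d →L[ℂ] L2 d

/-- A bounded continuous function is essentially bounded. -/
theorem memLp_top_of_bcf {d : ℕ} (f : X d →ᵇ ℂ) :
    MemLp (fun x => f x) ∞ (volume : Measure (X d)) :=
  memLp_top_of_bound f.continuous.aestronglyMeasurable ‖f‖
    (Filter.Eventually.of_forall f.norm_coe_le_norm)

/-- The operator `f(q)` of multiplication by a bounded continuous function `f`. -/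
def mulOp {d : ℕ} (f : X d →ᵇ ℂ) : BddOp d :=
  (ContinuousLinearMap.mul ℂ ℂ).holderL (volume : Measure (X d)) ∞ 2 2
    (memLp_top_of_bcf f).toLp

theorem mulOp_apply_ae {d : ℕ} (f : X d →ᵇ ℂ) (u : L2 d) :
    ∀ᵐ x : X d, mulOp f u x = f x * u x := by
  filter_upwards [ContinuousLinearMap.coeFn_holder (r := 2) (ContinuousLinearMap.mul ℂ ℂ)
    (memLp_top_of_bcf f).toLp u, (memLp_top_of_bcf f).coeFn_toLp] with x hx hf
  simp only [hf] at hx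
  exact hx

/-- The function `x ↦ e^{i a·x}` as a bounded continuous function. -/
def expFun {d : ℕ} (a : X d) : X d →ᵇ ℂ :=
  BoundedContinuousFunction.ofNormedAddCommGroup
    (fun x => Complex.exp (Complex.I * ((inner ℝ a x : ℝ) : ℂ))) (by fun_prop) 1
    (fun x => by rw [mul_comm, Complex.norm_exp_ofReal_mul_I])

/-- The operator `e^{iaq}`, i.e. `(e^{iaq} u)(x) = e^{i a·x} u(x)`. -/
def expQ {d : ℕ} (a : X d) : BddOp d := mulOp (expFun a)

theorem expQ_apply_ae {d : ℕ} (a : X d) (u : L2 d) :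
    ∀ᵐ x : X d, expQ a u x = Complex.exp (Complex.I * ((inner ℝ a x : ℝ) : ℂ)) * u x :=
  mulOp_apply_ae (expFun a) u

/-- The operator `e^{iap}`, i.e. `(e^{iap} u)(x) = u(x + a)`. -/
def expP {d : ℕ} (a : X d) : BddOp d :=
  (Lp.compMeasurePreservingₗᵢ ℂ (fun x : X d => x + a)
    (measurePreserving_add_right volume a)).toContinuousLinearMap

theorem expP_apply_ae {d : ℕ} (a : X d) (u : L2 d) :
    ∀ᵐ x : X d, expP a u x = u (x + a) :=
  Lp.coeFn_compMeasurePreserving u (measurePreserving_add_right volume a)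

/-- The translate `τ_a(A) = e^{iap} A e^{-iap}` of an operator. -/
def translate {d : ℕ} (a : X d) (A : BddOp d) : BddOp d := expP a * A * expP (-a)

/-- The elliptic algebra: the bounded operators `A` such that, in operator norm as `a → 0`,
`(e^{iap} - 1) A → 0`, `(e^{iap} - 1) A* → 0` and `e^{-iaq} A e^{iaq} → A`. -/
def ellipticAlgebra (d : ℕ) : Set (BddOp d) :=
  {A | Tendsto (fun a : X d => ‖(expP a - 1) * A‖) (𝓝 0) (𝓝 0) ∧
    Tendsto (fun a : X d => ‖(expP a - 1) * ContinuousLinearMap.adjoint A‖) (𝓝 0) (𝓝 0) ∧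
    Tendsto (fun a : X d => ‖expQ (-a) * A * expQ a - A‖) (𝓝 0) (𝓝 0)}

/-- The seminorm `A ↦ ‖A θ(q)‖` attached to a continuous function `θ` vanishing at infinity. -/
def localSeminorm {d : ℕ} (θ : C₀(X d, ℂ)) : Seminorm ℂ (BddOp d) :=
  (normSeminorm ℂ (BddOp d)).comp (LinearMap.mulRight ℂ (mulOp θ.toBCF))

/-- The local norm topology on bounded operators: the locally convex topology defined by the
seminorms `A ↦ ‖A θ(q)‖`, with `θ` in `C₀(X)`. -/
@[reducible]
def localNormTopology (d : ℕ) : TopologicalSpace (BddOp d) :=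
  SeminormFamily.moduleFilterBasis (localSeminorm :
    SeminormFamily ℂ (BddOp d) C₀(X d, ℂ)) |>.topology

/-- Convergence of a family of operators along a filter, in the local norm topology. -/
def LocalNormTendsto {d : ℕ} {ι : Type*} (F : ι → BddOp d) (l : Filter ι) (B : BddOp d) : Prop :=
  Tendsto F l (@nhds (BddOp d) (localNormTopology d) B)

/-- The set of ultrafilters on `X` which contain the complements of all bounded sets. -/
def ultrafiltersAtInfinity (d : ℕ) : Set (Ultrafilter (X d)) :=
  {κ | (κ : Filter (X d)) ≤ Bornology.cobounded (X d)}

/-- The essential spectrum: the complex numbers `z` such that `A - z` is not Fredholm. -/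
def essSpectrum {d : ℕ} (A : BddOp d) : Set ℂ :=
  {z | ¬ ContinuousLinearMap.IsFredholm (A - z • (1 : BddOp d))}

end EllipticAlgebra

end

/-! Conjugation by translations preserves norms, commutes with `expP` and changes `expQ` only by a
phase. The continuity conditions defining the elliptic algebra therefore hold for all translates of
`A` with the same moduli, and two uniform facts follow: one about compactness and one about
localization.

Compactness. For θ in C₀ the operators θ(q) τ_x(A) and τ_x(A) θ(q) are norm-approximated by
operators with range in one finite-dimensional space, uniformly in x; this is the quantitative
Kolmogorov-Riesz criterion `exists_uniform_finiteRank_approx`. Applying it to A and to A* compresses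
τ_x(A) θ(q) on both sides to a bounded family in finite dimension, which converges along every
ultrafilter. This produces the limits (`exists_localNormTendsto_translate`).

An operator is Fredholm exactly when it and its adjoint are bounded below modulo a finite rank term.
Translates u(· - x) tend weakly to 0 at infinity, so finite rank terms disappear in the limit. Hence
if A - z is Fredholm, each limit minus z and its adjoint are bounded below, and the limit minus z is
invertible (`isUnit_sub_of_isFredholm`).

Conversely let A - z fail to be Fredholm with z ≠ 0. If A - z and its adjoint were both bounded
below on vectors supported far away, the compactness of χ(q) A and the identity z χ = χ A - χ (A -
z) would control the remaining part near the origin and make A - z Fredholm. So one of them has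
approximate kernel vectors arbitrarily far out. These may be widely spread, whereas local norm
convergence only sees vectors of bounded support.

Localization. Since A almost commutes with e^{iaq} for small a, it almost commutes on average with
multiplication by Fejér-like trigonometric polynomials. These cut an approximate kernel vector into
pieces whose size depends only on the precision, and some piece is still an approximate kernel
vector (`QContinuous.exists_localization`). Nesting the cuts
(`QContinuous.exists_nested_localization`) makes a single sequence of centres serve all precisions,
so a single ultrafilter gives a limit minus z which is not bounded below.

The point z = 0 is separate: a limit B inherits the smallness of (e^{iap} - 1) B, while ‖e^{iap} -
1‖ ≥ 1 for a ≠ 0, so B is never invertible (`not_isUnit_limit`). In dimension 0 everything is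
finite-dimensional and there is no essential spectrum. -/

noncomputable section

namespace EllipticAlgebra

/-! ### Multiplication and translation operators, and their Weyl relations. -/

section OperatorCalculus

variable {d : ℕ}

theorem mulOp_add (f g : X d →ᵇ ℂ) : mulOp (f + g) = mulOp f + mulOp g := by
  ext u
  simp only [add_apply]
  filter_upwards [mulOp_apply_ae (f + g) u, mulOp_apply_ae f u, mulOp_apply_ae g u,
    Lp.coeFn_add (mulOp f u) (mulOp g u)] with x h1 h2 h3 h4
  rw [h1, h4, Pi.add_apply, h2, h3, BoundedContinuousFunction.add_apply, add_mul]

theorem mulOp_smul (c : ℂ) (f : X d →ᵇ ℂ) : mulOp (c • f) = c • mulOp f := by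
  ext u
  simp only [smul_apply]
  filter_upwards [mulOp_apply_ae (c • f) u, mulOp_apply_ae f u,
    Lp.coeFn_smul c (mulOp f u)] with x h1 h2 h4
  rw [h1, h4, Pi.smul_apply, h2, BoundedContinuousFunction.smul_apply, smul_eq_mul, smul_eq_mul,
    mul_assoc]

theorem mulOp_mul (f g : X d →ᵇ ℂ) : mulOp (f * g) = mulOp f * mulOp g := by
  ext u
  simp only [mul_apply_eq_comp]
  filter_upwards [mulOp_apply_ae (f * g) u, mulOp_apply_ae f (mulOp g u),
    mulOp_apply_ae g u] with x h1 h2 h3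
  rw [h1, h2, h3, BoundedContinuousFunction.mul_apply, mul_assoc]

theorem mulOp_one : mulOp (1 : X d →ᵇ ℂ) = 1 := by
  ext u
  filter_upwards [mulOp_apply_ae (1 : X d →ᵇ ℂ) u] with x h1
  rw [h1, one_apply_eq_self, BoundedContinuousFunction.coe_one, Pi.one_apply, one_mul]

theorem mulOp_neg (f : X d →ᵇ ℂ) : mulOp (-f) = -mulOp f := by
  have := mulOp_smul (-1) f
  simpa using this

theorem mulOp_sub (f g : X d →ᵇ ℂ) : mulOp (f - g) = mulOp f - mulOp g := by
  rw [sub_eq_add_neg, mulOp_add, mulOp_neg, sub_eq_add_neg]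

/-- The squared norm of `u` as a Lebesgue integral. -/
theorem lintegral_enorm_sq (u : L2 d) : ∫⁻ x, ‖u x‖ₑ ^ 2 = ENNReal.ofReal (‖u‖ ^ 2) := by
  have h : ‖u‖ₑ = (∫⁻ x, ‖u x‖ₑ ^ 2) ^ (1 / 2 : ℝ) := by
    rw [Lp.enorm_def, eLpNorm_eq_lintegral_rpow_enorm_toReal (by norm_num) (by norm_num)]
    simp
  rw [ENNReal.ofReal_pow (norm_nonneg _), ofReal_norm, h, ← ENNReal.rpow_natCast,
    ← ENNReal.rpow_mul]
  norm_num

theorem integrable_norm_sq (u : L2 d) : Integrable (fun x => ‖u x‖ ^ 2) :=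
  (memLp_two_iff_integrable_sq_norm (Lp.aestronglyMeasurable u)).1 (Lp.memLp u)

theorem norm_sq_eq_integral (u : L2 d) : ‖u‖ ^ 2 = ∫ x, ‖u x‖ ^ 2 := by
  rw [integral_eq_lintegral_of_nonneg_ae (Eventually.of_forall fun x => by positivity)
    (integrable_norm_sq u).aestronglyMeasurable]
  have : ∀ x, ENNReal.ofReal (‖u x‖ ^ 2) = ‖u x‖ₑ ^ 2 := fun x => by
    rw [ENNReal.ofReal_pow (norm_nonneg _), ofReal_norm]
  simp_rw [this]
  rw [lintegral_enorm_sq, ENNReal.toReal_ofReal (by positivity)]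

theorem norm_mulOp_apply_le (f : X d →ᵇ ℂ) (u : L2 d) {c : ℝ}
    (h : ∀ x, ‖f x‖ ≤ c) : ‖mulOp f u‖ ≤ c * ‖u‖ := by
  refine Lp.norm_le_mul_norm_of_ae_le_mul ?_
  filter_upwards [mulOp_apply_ae f u] with x hx
  rw [hx, norm_mul]
  exact mul_le_mul_of_nonneg_right (h x) (norm_nonneg _)

theorem norm_mulOp_le (f : X d →ᵇ ℂ) : ‖mulOp f‖ ≤ ‖f‖ :=
  ContinuousLinearMap.opNorm_le_bound _ (norm_nonneg _) fun u =>
    norm_mulOp_apply_le f u f.norm_coe_le_norm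

theorem norm_mulOp_le_of_le (f : X d →ᵇ ℂ) {c : ℝ} (hc : 0 ≤ c) (h : ∀ x, ‖f x‖ ≤ c) :
    ‖mulOp f‖ ≤ c :=
  ContinuousLinearMap.opNorm_le_bound _ hc fun u => norm_mulOp_apply_le f u h

theorem adjoint_mulOp (f : X d →ᵇ ℂ) : ContinuousLinearMap.adjoint (mulOp f) = mulOp (star f) := by
  symm
  rw [ContinuousLinearMap.eq_adjoint_iff]
  intro u v
  rw [L2.inner_def, L2.inner_def]
  refine integral_congr_ae ?_
  filter_upwards [mulOp_apply_ae (star f) u, mulOp_apply_ae f v] with x h1 h2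
  rw [h1, h2]
  simp only [RCLike.inner_apply, BoundedContinuousFunction.star_apply, map_mul, RCLike.star_def,
    Complex.conj_conj]
  ring

theorem norm_expP_apply (a : X d) (u : L2 d) : ‖expP a u‖ = ‖u‖ :=
  (Lp.compMeasurePreservingₗᵢ ℂ (fun x : X d => x + a)
    (measurePreserving_add_right volume a)).norm_map u

theorem ae_add_right {p : X d → Prop} (a : X d) (h : ∀ᵐ x, p x) : ∀ᵐ x, p (x + a) :=
  (measurePreserving_add_right volume a).quasiMeasurePreserving.ae h

theorem expP_mul (a b : X d) : expP a * expP b = expP (a + b) := by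
  ext u
  filter_upwards [expP_apply_ae a (expP b u), ae_add_right a (expP_apply_ae b u),
    expP_apply_ae (a + b) u] with x h1 h2 h3
  rw [mul_apply_eq_comp, h1, h2, h3, add_assoc]

theorem expP_zero : expP (0 : X d) = 1 := by
  ext u
  filter_upwards [expP_apply_ae 0 u] with x h1
  rw [h1, add_zero, one_apply_eq_self]

theorem expP_mul_neg (a : X d) : expP a * expP (-a) = 1 := by
  rw [expP_mul, add_neg_cancel, expP_zero]

theorem expP_neg_mul (a : X d) : expP (-a) * expP a = 1 := by
  rw [expP_mul, neg_add_cancel, expP_zero]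

theorem norm_expP_le (a : X d) : ‖expP a‖ ≤ 1 :=
  ContinuousLinearMap.opNorm_le_bound _ zero_le_one fun u => by rw [norm_expP_apply, one_mul]

theorem inner_expP_expP (a : X d) (u v : L2 d) : inner ℂ (expP a u) (expP a v) = inner ℂ u v :=
  (Lp.compMeasurePreservingₗᵢ ℂ (fun x : X d => x + a)
    (measurePreserving_add_right volume a)).inner_map_map u v

theorem adjoint_expP (a : X d) : ContinuousLinearMap.adjoint (expP a) = expP (-a) := by
  symm
  rw [ContinuousLinearMap.eq_adjoint_iff]
  intro u v
  rw [← inner_expP_expP a, ← mul_apply_eq_comp, expP_mul_neg,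
    one_apply_eq_self]

theorem norm_expP_mul (a : X d) (B : BddOp d) : ‖expP a * B‖ = ‖B‖ := by
  refine le_antisymm ((norm_mul_le _ _).trans
    (mul_le_of_le_one_left (norm_nonneg _) (norm_expP_le a))) ?_
  calc ‖B‖ = ‖expP (-a) * (expP a * B)‖ := by rw [← mul_assoc, expP_neg_mul, one_mul]
    _ ≤ _ := (norm_mul_le _ _).trans (mul_le_of_le_one_left (norm_nonneg _) (norm_expP_le _))

theorem norm_mul_expP (a : X d) (B : BddOp d) : ‖B * expP a‖ = ‖B‖ := by
  refine le_antisymm ((norm_mul_le _ _).trans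
    (mul_le_of_le_one_right (norm_nonneg _) (norm_expP_le a))) ?_
  calc ‖B‖ = ‖(B * expP a) * expP (-a)‖ := by rw [mul_assoc, expP_mul_neg, mul_one]
    _ ≤ _ := (norm_mul_le _ _).trans (mul_le_of_le_one_right (norm_nonneg _) (norm_expP_le _))

theorem norm_translate (a : X d) (B : BddOp d) : ‖translate a B‖ = ‖B‖ := by
  rw [translate, norm_mul_expP, norm_expP_mul]

theorem translate_sub (a : X d) (A B : BddOp d) :
    translate a (A - B) = translate a A - translate a B := by
  simp only [translate, mul_sub, sub_mul]

theorem translate_mul (a : X d) (A B : BddOp d) :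
    translate a (A * B) = translate a A * translate a B := by
  simp only [translate]
  rw [show expP a * A * expP (-a) * (expP a * B * expP (-a)) =
    expP a * A * (expP (-a) * expP a) * B * expP (-a) by simp only [mul_assoc], expP_neg_mul]
  simp only [mul_assoc, one_mul]

theorem translate_expP (a b : X d) : translate a (expP b) = expP b := by
  rw [translate, expP_mul, expP_mul]
  congr 1
  abel

theorem translate_one (a : X d) : translate a (1 : BddOp d) = 1 := by
  rw [translate, mul_one, expP_mul_neg]

theorem adjoint_mul (A B : BddOp d) : ContinuousLinearMap.adjoint (A * B) =
    ContinuousLinearMap.adjoint B * ContinuousLinearMap.adjoint A :=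
  ContinuousLinearMap.adjoint_comp A B

theorem norm_adjoint (A : BddOp d) : ‖ContinuousLinearMap.adjoint A‖ = ‖A‖ :=
  LinearIsometryEquiv.norm_map _ A

theorem adjoint_translate (a : X d) (A : BddOp d) :
    ContinuousLinearMap.adjoint (translate a A) = translate a (ContinuousLinearMap.adjoint A) := by
  simp only [translate, adjoint_mul, adjoint_expP, neg_neg, mul_assoc]

theorem expQ_mul (a b : X d) : expQ a * expQ b = expQ (a + b) := by
  rw [expQ, expQ, expQ, ← mulOp_mul]
  congr 1
  ext x
  simp only [expFun, BoundedContinuousFunction.mul_apply,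
    BoundedContinuousFunction.coe_ofNormedAddCommGroup, ← Complex.exp_add, inner_add_left]
  push_cast
  ring_nf

theorem expQ_zero : expQ (0 : X d) = 1 := by
  rw [expQ, ← mulOp_one]
  congr 1
  ext x
  simp [expFun]

theorem expQ_neg_mul (a : X d) : expQ (-a) * expQ a = 1 := by
  rw [expQ_mul, neg_add_cancel, expQ_zero]

theorem adjoint_expQ (a : X d) : ContinuousLinearMap.adjoint (expQ a) = expQ (-a) := by
  rw [expQ, adjoint_mulOp, expQ]
  congr 1
  ext x
  simp [expFun, ← Complex.exp_conj]

theorem norm_expQ_le (a : X d) : ‖expQ a‖ ≤ 1 :=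
  norm_mulOp_le_of_le _ zero_le_one fun x => by
    simp only [expFun, BoundedContinuousFunction.coe_ofNormedAddCommGroup]
    rw [mul_comm, Complex.norm_exp_ofReal_mul_I]

theorem norm_expQ_mul (a : X d) (B : BddOp d) : ‖expQ a * B‖ = ‖B‖ := by
  refine le_antisymm ((norm_mul_le _ _).trans
    (mul_le_of_le_one_left (norm_nonneg _) (norm_expQ_le a))) ?_
  calc ‖B‖ = ‖expQ (-a) * (expQ a * B)‖ := by rw [← mul_assoc, expQ_neg_mul, one_mul]
    _ ≤ _ := (norm_mul_le _ _).trans (mul_le_of_le_one_left (norm_nonneg _) (norm_expQ_le _))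

/-- The Weyl commutation relations. -/
theorem expP_mul_expQ (a b : X d) :
    expP b * expQ a = Complex.exp (Complex.I * ((inner ℝ a b : ℝ) : ℂ)) • (expQ a * expP b) := by
  ext u
  simp only [smul_apply, mul_apply_eq_comp]
  filter_upwards [expP_apply_ae b (expQ a u), ae_add_right b (expQ_apply_ae a u),
    expQ_apply_ae a (expP b u), expP_apply_ae b u, Lp.coeFn_smul
      (Complex.exp (Complex.I * ((inner ℝ a b : ℝ) : ℂ))) (expQ a (expP b u))] with x h1 h2 h3 h4 h5
  rw [h1, h2, h5, Pi.smul_apply, h3, h4, smul_eq_mul, inner_add_right]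
  push_cast
  rw [mul_add, Complex.exp_add]
  ring

/-- Translating `e^{iaq}` multiplies it by a phase. -/
theorem translate_expQ (b a : X d) : translate b (expQ a) =
    Complex.exp (Complex.I * ((inner ℝ a b : ℝ) : ℂ)) • expQ a := by
  rw [translate, expP_mul_expQ, smul_mul_assoc, mul_assoc, expP_mul_neg, mul_one]

/-- The two Weyl phases cancel. Hence all translates of an operator share its modulus of continuity
under conjugation by `expQ`. -/
theorem translate_conj_expQ (b a : X d) (B : BddOp d) :
    expQ (-a) * translate b B * expQ a = translate b (expQ (-a) * B * expQ a) := by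
  rw [translate_mul, translate_mul, translate_expQ, translate_expQ, smul_mul_assoc, smul_mul_assoc,
    mul_smul_comm, smul_smul, ← Complex.exp_add, inner_neg_left]
  push_cast
  rw [mul_neg, neg_add_cancel, Complex.exp_zero, one_smul]

theorem adjoint_conj_expQ (a : X d) (B : BddOp d) :
    ContinuousLinearMap.adjoint (expQ (-a) * B * expQ a) =
      expQ (-a) * ContinuousLinearMap.adjoint B * expQ a := by
  simp only [adjoint_mul, adjoint_expQ, neg_neg, mul_assoc]

theorem adjoint_mem_ellipticAlgebra {A : BddOp d} (hA : A ∈ ellipticAlgebra d) :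
    ContinuousLinearMap.adjoint A ∈ ellipticAlgebra d := by
  refine ⟨hA.2.1, by simpa using hA.1, ?_⟩
  refine hA.2.2.congr fun a => ?_
  rw [← adjoint_conj_expQ, ← map_sub, norm_adjoint]

end OperatorCalculus

/-! ### Fredholm operators via lower bounds modulo finite rank. -/

section Fredholm

open ContinuousLinearMap

variable {H : Type*} [NormedAddCommGroup H] [InnerProductSpace ℂ H]

/-- `T` is bounded below up to an operator of finite rank. -/
def IsBoundedBelowModFiniteRank (T : H →L[ℂ] H) : Prop :=
  ∃ (C : ℝ) (F : H →L[ℂ] H), 0 ≤ C ∧ F.toLinearMap.HasFiniteRange ∧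
    ∀ u, ‖u‖ ≤ C * (‖T u‖ + ‖F u‖)

theorem isBoundedBelowModFiniteRank_of_leftInverse {T S : H →L[ℂ] H}
    (hS : (S * T - 1).toLinearMap.HasFiniteRange) : IsBoundedBelowModFiniteRank T := by
  refine ⟨max 1 ‖S‖, S * T - 1, by positivity, hS, fun u => ?_⟩
  calc ‖u‖ = ‖S (T u) - (S * T - 1) u‖ := by simp
    _ ≤ ‖S (T u)‖ + ‖(S * T - 1) u‖ := norm_sub_le _ _
    _ ≤ max 1 ‖S‖ * ‖T u‖ + max 1 ‖S‖ * ‖(S * T - 1) u‖ := by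
        gcongr
        · exact (S.le_opNorm _).trans (by gcongr; exact le_max_right _ _)
        · exact le_mul_of_one_le_left (norm_nonneg _) (le_max_left _ _)
    _ = _ := by ring

/-- Approximate finite rank perturbations may replace the finite rank perturbation. -/
theorem isBoundedBelowModFiniteRank_of_approx {T K : H →L[ℂ] H} {C : ℝ} (hC : 0 ≤ C)
    (h : ∀ u, ‖u‖ ≤ C * (‖T u‖ + ‖K u‖))
    (hK : ∀ ε > 0, ∃ F : H →L[ℂ] H, F.toLinearMap.HasFiniteRange ∧ ‖K - F‖ ≤ ε) :
    IsBoundedBelowModFiniteRank T := by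
  -- At this precision the error C‖(K - F) u‖ is at most ‖u‖/2 and can be absorbed on the left.
  obtain ⟨F, hF, hFK⟩ := hK (1 / (2 * (C + 1))) (by positivity)
  refine ⟨2 * C, F, by positivity, hF, fun u => ?_⟩
  have h1 : ‖K u‖ ≤ ‖F u‖ + 1 / (2 * (C + 1)) * ‖u‖ := by
    calc ‖K u‖ = ‖F u + (K - F) u‖ := by simp
      _ ≤ ‖F u‖ + ‖(K - F) u‖ := norm_add_le _ _
      _ ≤ _ := by gcongr; exact ContinuousLinearMap.le_of_opNorm_le _ hFK _
  have h2 : C * (1 / (2 * (C + 1)) * ‖u‖) ≤ ‖u‖ / 2 := by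
    have : C * (1 / (2 * (C + 1))) ≤ 1 / 2 := by
      rw [mul_one_div, div_le_div_iff₀ (by positivity) (by positivity)]
      linarith
    nlinarith [norm_nonneg u]
  have h3 := h u
  nlinarith [mul_le_mul_of_nonneg_left h1 hC]

theorem isFredholm_of_finiteDimensional [FiniteDimensional ℂ H] (T : H →L[ℂ] H) :
    IsFredholm T :=
  isFredholm_iff_exists_isQuasiInverse.2 ⟨0,
    LinearMap.FiniteRangeSetoid.equiv_iff_hasFiniteRange.2 LinearMap.HasFiniteRange.of_finite_dom,
    LinearMap.FiniteRangeSetoid.equiv_iff_hasFiniteRange.2 LinearMap.HasFiniteRange.of_finite_dom⟩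

variable [CompleteSpace H]

/-- An operator is invertible as soon as it and its adjoint are bounded below. -/
theorem isUnit_of_bounded_below {T : H →L[ℂ] H} {C : ℝ} (hC : 0 ≤ C) (h : ∀ u, ‖u‖ ≤ C * ‖T u‖)
    (h' : ∀ u, ‖u‖ ≤ C * ‖adjoint T u‖) : IsUnit T := by
  have hanti : AntilipschitzWith C.toNNReal T := by
    refine AddMonoidHomClass.antilipschitz_of_bound T fun u => ?_
    rw [Real.coe_toNNReal C hC]
    exact h u
  rw [isUnit_iff_bijective, bijective_iff_dense_range_and_antilipschitz]
  refine ⟨?_, _, hanti⟩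
  rw [Submodule.topologicalClosure_eq_top_iff, Submodule.eq_bot_iff]
  intro u hu
  have : adjoint T u = 0 := by
    refine ext_inner_right ℂ fun v => ?_
    rw [adjoint_inner_left, inner_zero_left]
    exact (Submodule.mem_orthogonal' _ _).1 hu _ ⟨v, rfl⟩
  have h0 := h' u
  rw [this, norm_zero, mul_zero] at h0
  exact norm_le_zero_iff.1 h0

/-- The self-adjoint operator P = T*T + F*F is bounded below, hence invertible, and P⁻¹T* is a left
inverse of T up to -P⁻¹F*F, which has finite rank. -/
theorem IsBoundedBelowModFiniteRank.exists_leftInverse {T : H →L[ℂ] H}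
    (hT : IsBoundedBelowModFiniteRank T) :
    ∃ S : H →L[ℂ] H, (S * T - 1).toLinearMap.HasFiniteRange := by
  obtain ⟨C, F, hC, hF, h⟩ := hT
  set P : H →L[ℂ] H := adjoint T * T + adjoint F * F with hP
  have hPadj : adjoint P = P := by
    rw [hP, map_add]
    change adjoint (adjoint T ∘L T) + adjoint (adjoint F ∘L F) = _
    rw [adjoint_comp, adjoint_comp, adjoint_adjoint, adjoint_adjoint]
    rfl
  have hinner : ∀ u, inner ℂ (P u) u = ((‖T u‖ ^ 2 + ‖F u‖ ^ 2 : ℝ) : ℂ) := fun u => by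
    rw [hP, add_apply, inner_add_left, mul_apply_eq_comp, mul_apply_eq_comp, adjoint_inner_left,
      adjoint_inner_left, inner_self_eq_norm_sq_to_K, inner_self_eq_norm_sq_to_K]
    push_cast
    rfl
  have hbelow : ∀ u, ‖u‖ ≤ 2 * C ^ 2 * ‖P u‖ := fun u => by
    have h1 : ‖T u‖ ^ 2 + ‖F u‖ ^ 2 ≤ ‖P u‖ * ‖u‖ := by
      have := norm_inner_le_norm (𝕜 := ℂ) (P u) u
      rw [hinner, Complex.norm_real, Real.norm_of_nonneg (by positivity)] at this
      exact this
    have h2 : ‖u‖ ^ 2 ≤ 2 * C ^ 2 * (‖P u‖ * ‖u‖) := by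
      calc ‖u‖ ^ 2 ≤ (C * (‖T u‖ + ‖F u‖)) ^ 2 := pow_le_pow_left₀ (norm_nonneg _) (h u) 2
        _ = C ^ 2 * (‖T u‖ + ‖F u‖) ^ 2 := by ring
        _ ≤ C ^ 2 * (2 * (‖T u‖ ^ 2 + ‖F u‖ ^ 2)) := by
            gcongr
            nlinarith [sq_nonneg (‖T u‖ - ‖F u‖)]
        _ ≤ C ^ 2 * (2 * (‖P u‖ * ‖u‖)) := by gcongr
        _ = _ := by ring
    rcases eq_or_lt_of_le (norm_nonneg u) with h0 | h0
    · rw [← h0]; positivity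
    · refine le_of_mul_le_mul_right ?_ h0
      nlinarith
  have hunit : IsUnit P :=
    isUnit_of_bounded_below (C := 2 * C ^ 2) (by positivity) hbelow (by rwa [hPadj])
  obtain ⟨Q, hQ⟩ := hunit
  refine ⟨(↑Q⁻¹ : H →L[ℂ] H) * adjoint T, ?_⟩
  have : (↑Q⁻¹ : H →L[ℂ] H) * adjoint T * T - 1 =
      -((↑Q⁻¹ : H →L[ℂ] H) * adjoint F * F) := by
    have h1 : (↑Q⁻¹ : H →L[ℂ] H) * P = 1 := by rw [← hQ, Units.inv_mul]
    rw [hP, mul_add] at h1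
    rw [← h1, mul_assoc, mul_assoc]
    abel
  rw [this]
  refine LinearMap.HasFiniteRange.neg ?_
  exact hF.comp_left _

/-- With E the orthogonal projection onto the range, F = EF gives F* = F*E. -/
theorem hasFiniteRange_adjoint {F : H →L[ℂ] H} (hF : F.toLinearMap.HasFiniteRange) :
    (adjoint F).toLinearMap.HasFiniteRange := by
  have : FiniteDimensional ℂ F.range := Module.Finite.of_fg hF.fg_range
  set E := F.range.starProjection
  have h1 : F = E ∘L F := by
    ext u
    exact (Submodule.starProjection_eq_self_iff.2 (LinearMap.mem_range_self F.toLinearMap u)).symm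
  have hE : E.toLinearMap.HasFiniteRange := by
    have : E.toLinearMap = F.range.subtype ∘ₗ F.range.orthogonalProjectionOnto.toLinearMap := rfl
    rw [this]
    exact LinearMap.HasFiniteRange.of_finite_dom.comp_right _
  rw [h1, adjoint_comp]
  have h2 : adjoint E = E := (Submodule.starProjection_isSymmetric _).isSelfAdjoint.adjoint_eq
  rw [h2]
  exact hE.comp_left _

theorem isFredholm_of_isBoundedBelowModFiniteRank {T : H →L[ℂ] H}
    (h : IsBoundedBelowModFiniteRank T) (h' : IsBoundedBelowModFiniteRank (adjoint T)) :
    IsFredholm T := by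
  obtain ⟨S, hS⟩ := h.exists_leftInverse
  obtain ⟨S', hS'⟩ := h'.exists_leftInverse
  have hR : (T * adjoint S' - 1).toLinearMap.HasFiniteRange := by
    have := hasFiniteRange_adjoint hS'
    have h1 : adjoint (S' * adjoint T - 1) = T * adjoint S' - 1 := by
      rw [map_sub]
      change adjoint (S' ∘L adjoint T) - adjoint (ContinuousLinearMap.id ℂ H) = _
      rw [adjoint_comp, adjoint_adjoint, adjoint_id]
      rfl
    rwa [h1] at this
  refine isFredholm_iff_exists_isQuasiInverse.2 ⟨S, ?_, ?_⟩
  · exact LinearMap.FiniteRangeSetoid.equiv_iff_hasFiniteRange.2 hS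
  · refine LinearMap.FiniteRangeSetoid.equiv_iff_hasFiniteRange.2 ?_
    -- Left and right inverses modulo finite rank agree modulo finite rank, so S itself is also a
    -- right one.
    have h2 : T * S - 1 = (T * adjoint S' - 1) + T * (S * T - 1) * adjoint S'
        - T * S * (T * adjoint S' - 1) := by
      noncomm_ring
    change (T * S - 1).toLinearMap.HasFiniteRange
    rw [h2]
    refine LinearMap.HasFiniteRange.sub (LinearMap.HasFiniteRange.add hR ?_) ?_
    · exact LinearMap.HasFiniteRange.comp_right (LinearMap.HasFiniteRange.comp_left hS _) _
    · exact hR.comp_left _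

theorem IsFredholm.isBoundedBelowModFiniteRank {T : H →L[ℂ] H} (hT : IsFredholm T) :
    IsBoundedBelowModFiniteRank T ∧ IsBoundedBelowModFiniteRank (adjoint T) := by
  obtain ⟨S, h1, h2⟩ := hT.exists_isQuasiInverse
  have h1' : (S * T - 1).toLinearMap.HasFiniteRange :=
    LinearMap.FiniteRangeSetoid.equiv_iff_hasFiniteRange.1 h1
  have h2' : (T * S - 1).toLinearMap.HasFiniteRange :=
    LinearMap.FiniteRangeSetoid.equiv_iff_hasFiniteRange.1 h2
  refine ⟨isBoundedBelowModFiniteRank_of_leftInverse h1',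
    isBoundedBelowModFiniteRank_of_leftInverse (S := adjoint S) ?_⟩
  have := hasFiniteRange_adjoint h2'
  have h3 : adjoint (T * S - 1) = adjoint S * adjoint T - 1 := by
    rw [map_sub]
    change adjoint (T ∘L S) - adjoint (ContinuousLinearMap.id ℂ H) = _
    rw [adjoint_comp, adjoint_id]
    rfl
  rwa [h3] at this

end Fredholm

/-! ### Discrete Fourier transform of a finite family of vectors. -/

section Parseval

variable {E : Type*} [NormedAddCommGroup E] [InnerProductSpace ℂ E]

/-- The `N`-th roots of unity, rotated by a fixed phase. -/
def rotatedRoot (N : ℕ) (σ : ℝ) (j : ℕ) : ℂ :=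
  Complex.exp (((-(2 * Real.pi * (j - σ) / N) : ℝ) : ℂ) * Complex.I)

theorem norm_rotatedRoot (N : ℕ) (σ : ℝ) (j : ℕ) : ‖rotatedRoot N σ j‖ = 1 :=
  Complex.norm_exp_ofReal_mul_I _

/-- The shift σ contributes a phase independent of j; what is left is a full geometric sum of a
nontrivial N-th root of unity. -/
theorem sum_conj_rotatedRoot_mul {N : ℕ} (σ : ℝ) {m n : ℕ} (hm : m < N) (hn : n < N) (hmn : m ≠ n) :
    ∑ j ∈ Finset.range N,
      (starRingEnd ℂ) (rotatedRoot N σ j ^ m) * rotatedRoot N σ j ^ n = 0 := by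
  have hN : N ≠ 0 := by omega
  have hNC : (N : ℂ) ≠ 0 := by exact_mod_cast hN
  set ζ := Complex.exp (2 * Real.pi * Complex.I / N) with hζ
  have hprim : IsPrimitiveRoot ζ N := Complex.isPrimitiveRoot_exp N hN
  have hζ0 : ζ ≠ 0 := Complex.exp_ne_zero _
  set q := ζ ^ m * (ζ ^ n)⁻¹ with hq
  have hq1 : q ≠ 1 := by
    intro h
    rw [hq, mul_inv_eq_one₀ (pow_ne_zero _ hζ0)] at h
    exact hmn (hprim.pow_inj hm hn h)
  have hqN : q ^ N = 1 := by
    rw [hq, mul_pow, inv_pow, ← pow_mul, ← pow_mul, mul_comm m, mul_comm n, pow_mul, pow_mul,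
      hprim.pow_eq_one]
    simp
  have hsum : ∑ j ∈ Finset.range N, q ^ j = 0 := by
    have := mul_geom_sum q N
    rw [hqN, sub_self] at this
    exact (mul_eq_zero.1 this).resolve_left (sub_ne_zero.2 hq1)
  have hterm : ∀ j : ℕ, (starRingEnd ℂ) (rotatedRoot N σ j ^ m) * rotatedRoot N σ j ^ n =
      Complex.exp (((2 * Real.pi * σ / N * (n - m) : ℝ) : ℂ) * Complex.I) * q ^ j := fun j => by
    rw [hq, hζ, rotatedRoot, map_pow, ← Complex.exp_conj, ← Complex.exp_nat_mul,
      ← Complex.exp_nat_mul, ← Complex.exp_nat_mul, ← Complex.exp_nat_mul, ← Complex.exp_neg,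
      ← Complex.exp_add, ← Complex.exp_add, ← Complex.exp_nat_mul, ← Complex.exp_add]
    congr 1
    simp only [map_mul, Complex.conj_ofReal, Complex.conj_I]
    push_cast
    ring
  rw [Finset.sum_congr rfl fun j _ => hterm j, ← Finset.mul_sum, hsum, mul_zero]

/-- Parseval's identity for the discrete Fourier transform of a family of vectors. -/
theorem sum_norm_sq_rotatedRoot (N : ℕ) (σ : ℝ) (w : ℕ → E) :
    ∑ j ∈ Finset.range N, ‖∑ m ∈ Finset.range N, rotatedRoot N σ j ^ m • w m‖ ^ 2 =
      N * ∑ m ∈ Finset.range N, ‖w m‖ ^ 2 := by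
  have key : ∑ j ∈ Finset.range N, inner ℂ (∑ m ∈ Finset.range N, rotatedRoot N σ j ^ m • w m)
      (∑ m ∈ Finset.range N, rotatedRoot N σ j ^ m • w m) =
      N * ∑ m ∈ Finset.range N, inner ℂ (w m) (w m) := by
    simp_rw [sum_inner, inner_sum, inner_smul_left, inner_smul_right]
    rw [Finset.sum_comm, Finset.mul_sum]
    refine Finset.sum_congr rfl fun m hm => ?_
    rw [Finset.sum_comm, Finset.sum_eq_single m]
    · have : ∀ j, (starRingEnd ℂ) (rotatedRoot N σ j ^ m) *
          (rotatedRoot N σ j ^ m * inner ℂ (w m) (w m)) = inner ℂ (w m) (w m) := fun j => by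
        rw [← mul_assoc, mul_comm ((starRingEnd ℂ) _), Complex.mul_conj, Complex.normSq_eq_norm_sq,
          norm_pow, norm_rotatedRoot]
        simp
      rw [Finset.sum_congr rfl fun j _ => this j]
      simp
    · intro n hn hnm
      have := sum_conj_rotatedRoot_mul (N := N) σ (Finset.mem_range.1 hm) (Finset.mem_range.1 hn)
        (Ne.symm hnm)
      simp_rw [← mul_assoc]
      rw [← Finset.sum_mul, this, zero_mul]
    · exact fun h => absurd hm h
  simp_rw [inner_self_eq_norm_sq_to_K] at key
  apply Complex.ofReal_injective
  push_cast
  exact key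

end Parseval

/-! ### Tent coefficients and a lower bound for the sine. -/

section Tent

/-- The tent function on `{0, …, N}`. -/
def tent (N m : ℕ) : ℝ := min (m : ℝ) (N - m)

theorem abs_tent_sub_le (N m : ℕ) : |tent N m - tent N (m + 1)| ≤ 1 := by
  unfold tent
  push_cast
  rw [abs_le]
  constructor <;> rcases min_cases (m : ℝ) (N - m) with h | h <;>
    rcases min_cases ((m : ℝ) + 1) (N - (m + 1)) with h' | h' <;> linarith [h.1, h.2, h'.1, h'.2]

theorem sum_tent_sub_sq_le (N : ℕ) :
    ∑ m ∈ Finset.range N, (tent N m - tent N (m + 1)) ^ 2 ≤ N := by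
  calc _ ≤ ∑ m ∈ Finset.range N, (1 : ℝ) := Finset.sum_le_sum fun m _ => by
        rw [← sq_abs]
        exact pow_le_one₀ (abs_nonneg _) (abs_tent_sub_le N m)
    _ = N := by simp

/-- On the middle half of the interval the tent has height at least M. The sum of squares is thus of
order N³, against order N for the increments: this gap is what concentrates the trigonometric
polynomials. -/
theorem le_sum_tent_sq (M : ℕ) :
    2 * (M : ℝ) ^ 3 ≤ ∑ m ∈ Finset.range (4 * M), tent (4 * M) m ^ 2 := by
  calc 2 * (M : ℝ) ^ 3 = ∑ m ∈ Finset.Ico M (3 * M), (M : ℝ) ^ 2 := by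
        rw [Finset.sum_const, Nat.card_Ico, show 3 * M - M = 2 * M by omega, nsmul_eq_mul]
        push_cast
        ring
    _ ≤ ∑ m ∈ Finset.Ico M (3 * M), tent (4 * M) m ^ 2 := by
        refine Finset.sum_le_sum fun m hm => pow_le_pow_left₀ (by positivity) ?_ 2
        rw [Finset.mem_Ico] at hm
        have h1 : (M : ℝ) ≤ m := by exact_mod_cast hm.1
        have h2 : (m : ℝ) ≤ 3 * M := by exact_mod_cast hm.2.le
        refine le_min h1 ?_
        push_cast
        linarith
    _ ≤ _ := by
        refine Finset.sum_le_sum_of_subset_of_nonneg (fun m hm => ?_) fun _ _ _ => sq_nonneg _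
        rw [Finset.mem_Ico] at hm
        rw [Finset.mem_range]
        omega

end Tent

/-- Jordan's inequality applies up to π/2; beyond it, reflection gives sin |y| ≥ 1/2. Staying away
from π is essential, and the choice of window in the localization argument ensures it. -/
theorem abs_le_mul_abs_sin {y : ℝ} (hy : |y| ≤ 3 * Real.pi / 4) :
    |y| ≤ 3 * Real.pi / 2 * |Real.sin y| := by
  have hpi := Real.pi_pos
  have h0 : 0 ≤ Real.sin |y| := Real.sin_nonneg_of_nonneg_of_le_pi (abs_nonneg y) (by linarith)
  have h1 : |Real.sin y| = Real.sin |y| := by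
    rcases abs_choice y with h | h
    · rw [h] at h0 ⊢; exact abs_of_nonneg h0
    · rw [h] at h0 ⊢
      rw [Real.sin_neg] at h0 ⊢
      exact abs_of_nonpos (by linarith)
  rw [h1]
  rcases le_total |y| (Real.pi / 2) with h | h
  · have h2 := Real.mul_le_sin (abs_nonneg y) h
    calc |y| = Real.pi / 2 * (2 / Real.pi * |y|) := by field_simp
      _ ≤ Real.pi / 2 * Real.sin |y| := by gcongr
      _ ≤ _ := by gcongr; linarith
  · have h2 := Real.mul_le_sin (x := Real.pi - |y|) (by linarith) (by linarith)
    rw [Real.sin_pi_sub] at h2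
    have h3 : 1 / 2 ≤ Real.sin |y| := by
      refine le_trans ?_ h2
      rw [div_mul_eq_mul_div, div_le_div_iff₀ (by norm_num) hpi]
      linarith
    nlinarith

/-! ### Supports, and summation by parts for trigonometric polynomials. -/

/-- Multiplication operators, as a homomorphism of algebras. -/
def mulOpHom (d : ℕ) : (X d →ᵇ ℂ) →ₐ[ℂ] BddOp d where
  toFun := mulOp
  map_one' := mulOp_one
  map_mul' := mulOp_mul
  map_zero' := by simpa using mulOp_smul 0 (0 : X d →ᵇ ℂ)
  map_add' := mulOp_add
  commutes' c := by
    rw [Algebra.algebraMap_eq_smul_one, Algebra.algebraMap_eq_smul_one, mulOp_smul, mulOp_one]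

theorem mulOpHom_apply {d : ℕ} (f : X d →ᵇ ℂ) : mulOpHom d f = mulOp f := rfl

/-- `u` vanishes almost everywhere outside `S`. -/
def SuppIn {d : ℕ} (u : L2 d) (S : Set (X d)) : Prop := ∀ᵐ x, x ∉ S → u x = 0

theorem SuppIn.mono {d : ℕ} {u : L2 d} {S S' : Set (X d)} (h : SuppIn u S) (hS : S ⊆ S') :
    SuppIn u S' := by
  filter_upwards [h] with x hx h'
  exact hx fun h'' => h' (hS h'')

theorem SuppIn.nonempty {d : ℕ} {u : L2 d} {S : Set (X d)} (h : SuppIn u S) (hu : u ≠ 0) :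
    S.Nonempty := by
  by_contra hS
  rw [Set.not_nonempty_iff_eq_empty] at hS
  apply hu
  rw [Lp.eq_zero_iff_ae_eq_zero]
  filter_upwards [h] with x hx
  exact hx (by rw [hS]; exact fun h => h)

theorem SuppIn.mulOp {d : ℕ} {u : L2 d} {S : Set (X d)} (h : SuppIn u S) (f : X d →ᵇ ℂ) :
    SuppIn (mulOp f u) (S ∩ {x | f x ≠ 0}) := by
  filter_upwards [h, mulOp_apply_ae f u] with x hx h1 h2
  rw [h1]
  by_cases hf : f x = 0
  · rw [hf, zero_mul]
  · rw [hx fun hS => h2 ⟨hS, hf⟩, mul_zero]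

/-- A comparison of functions on `S` yields a comparison of multiplication operators. -/
theorem SuppIn.norm_mulOp_le {d : ℕ} {u : L2 d} {S : Set (X d)} (h : SuppIn u S)
    (f g : X d →ᵇ ℂ) (c : ℝ) (hfg : ∀ x ∈ S, ‖f x‖ ≤ c * ‖g x‖) :
    ‖EllipticAlgebra.mulOp f u‖ ≤ c * ‖EllipticAlgebra.mulOp g u‖ := by
  refine Lp.norm_le_mul_norm_of_ae_le_mul ?_
  filter_upwards [h, mulOp_apply_ae f u, mulOp_apply_ae g u] with x hx hf hg
  rw [hf, hg, norm_mul, norm_mul, ← mul_assoc]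
  by_cases hS : x ∈ S
  · exact mul_le_mul_of_nonneg_right (hfg x hS) (norm_nonneg _)
  · rw [hx hS]; simp

/-- Summation by parts; the vanishing at both ends removes the boundary terms. -/
theorem sum_pow_telescope {R : Type*} [CommRing R] [Algebra ℂ R] (z : R) (N : ℕ) (c : ℕ → ℝ)
    (h0 : c 0 = 0) (hN : c N = 0) :
    (z - 1) * ∑ m ∈ Finset.range N, (c m : ℂ) • z ^ m =
      z * ∑ m ∈ Finset.range N, ((c m - c (m + 1) : ℝ) : ℂ) • z ^ m := by
  have h1 : ∑ m ∈ Finset.range N, (c m : ℂ) • z ^ m =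
      ∑ m ∈ Finset.range N, (c (m + 1) : ℂ) • z ^ (m + 1) := by
    have h2 := Finset.sum_range_succ (fun m => (c m : ℂ) • z ^ m) N
    have h3 := Finset.sum_range_succ' (fun m => (c m : ℂ) • z ^ m) N
    rw [h2, hN, h0] at h3
    simpa using h3
  rw [sub_mul, one_mul]
  nth_rewrite 2 [h1]
  rw [Finset.mul_sum, Finset.mul_sum, ← Finset.sum_sub_distrib]
  refine Finset.sum_congr rfl fun m _ => ?_
  push_cast
  rw [sub_smul, mul_sub, pow_succ', mul_smul_comm, mul_smul_comm]

/-! ### Localization of approximate kernel vectors. -/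

section Localization

variable {d : ℕ}

/-- The operators whose conjugates by `e^{iaq}` depend continuously on `a`. -/
def QContinuous (T : BddOp d) : Prop :=
  Tendsto (fun a : X d => ‖expQ (-a) * T * expQ a - T‖) (𝓝 0) (𝓝 0)

theorem norm_commutator_expQ (T : BddOp d) (a : X d) :
    ‖T * expQ a - expQ a * T‖ = ‖expQ (-a) * T * expQ a - T‖ := by
  rw [← norm_expQ_mul (-a) (T * expQ a - expQ a * T), mul_sub, ← mul_assoc, ← mul_assoc,
    expQ_neg_mul, one_mul]

theorem QContinuous.exists_norm_commutator_le {T : BddOp d} (hT : QContinuous T) {η : ℝ}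
    (hη : 0 < η) : ∃ r > 0, ∀ a : X d, ‖a‖ < r → ‖T * expQ a - expQ a * T‖ ≤ η := by
  obtain ⟨r, hr, h⟩ := Metric.eventually_nhds_iff.1 (hT.eventually (gt_mem_nhds hη))
  refine ⟨r, hr, fun a ha => ?_⟩
  rw [norm_commutator_expQ]
  exact (h (by rwa [dist_zero_right])).le

theorem norm_expFun (a x : X d) : ‖expFun a x‖ = 1 := by
  simp only [expFun, BoundedContinuousFunction.coe_ofNormedAddCommGroup]
  rw [mul_comm, Complex.norm_exp_ofReal_mul_I]

theorem expFun_pow (a : X d) (m : ℕ) : expFun a ^ m = expFun ((m : ℝ) • a) := by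
  ext x
  simp only [expFun, BoundedContinuousFunction.coe_pow, Pi.pow_apply,
    BoundedContinuousFunction.coe_ofNormedAddCommGroup, ← Complex.exp_nat_mul, inner_smul_left]
  congr 1
  push_cast
  simp
  ring

theorem norm_expQ_apply (a : X d) (u : L2 d) : ‖expQ a u‖ = ‖u‖ := by
  refine le_antisymm ?_ ?_
  · simpa using (expQ a).le_of_opNorm_le (norm_expQ_le a) u
  · have := (expQ (-a)).le_of_opNorm_le (norm_expQ_le (-a)) (expQ a u)
    rwa [← mul_apply_eq_comp, expQ_neg_mul, one_apply_eq_self, one_mul] at this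

/-- The function `e^{i(a·x - θ_j)}`, with `θ_j` running over shifted `N`-th parts of the circle. -/
def rotatedExp (a : X d) (N : ℕ) (σ : ℝ) (j : ℕ) : X d →ᵇ ℂ := rotatedRoot N σ j • expFun a

theorem mulOp_rotatedExp_pow (a : X d) (N : ℕ) (σ : ℝ) (j m : ℕ) :
    mulOp (rotatedExp a N σ j ^ m) = rotatedRoot N σ j ^ m • expQ ((m : ℝ) • a) := by
  rw [rotatedExp, smul_pow, mulOp_smul, expFun_pow, expQ]

theorem norm_rotatedExp (a : X d) (N : ℕ) (σ : ℝ) (j : ℕ) (x : X d) :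
    ‖rotatedExp a N σ j x‖ = 1 := by
  rw [rotatedExp, BoundedContinuousFunction.smul_apply, norm_smul, norm_rotatedRoot, norm_expFun,
    one_mul]

/-- The trigonometric polynomial with coefficients `c` in the variable `rotatedExp`. -/
def trigPoly (a : X d) (N : ℕ) (σ : ℝ) (c : ℕ → ℝ) (j : ℕ) : X d →ᵇ ℂ :=
  ∑ m ∈ Finset.range N, (c m : ℂ) • rotatedExp a N σ j ^ m

theorem mulOp_trigPoly (a : X d) (N : ℕ) (σ : ℝ) (c : ℕ → ℝ) (j : ℕ) :
    mulOp (trigPoly a N σ c j) = ∑ m ∈ Finset.range N, rotatedRoot N σ j ^ m •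
      ((c m : ℂ) • expQ ((m : ℝ) • a)) := by
  rw [← mulOpHom_apply, trigPoly, map_sum]
  refine Finset.sum_congr rfl fun m _ => ?_
  rw [map_smul, mulOpHom_apply, mulOp_rotatedExp_pow, smul_comm]

theorem sum_norm_sq_trigPoly (a : X d) (N : ℕ) (σ : ℝ) (c : ℕ → ℝ) (u : L2 d) :
    ∑ j ∈ Finset.range N, ‖mulOp (trigPoly a N σ c j) u‖ ^ 2 =
      N * (∑ m ∈ Finset.range N, c m ^ 2) * ‖u‖ ^ 2 := by
  have h := sum_norm_sq_rotatedRoot N σ fun m => (c m : ℂ) • expQ ((m : ℝ) • a) u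
  simp_rw [mulOp_trigPoly, sum_apply, smul_apply]
  rw [h, mul_assoc, Finset.sum_mul]
  congr 1
  refine Finset.sum_congr rfl fun m _ => ?_
  rw [norm_smul, norm_expQ_apply, mul_pow, Complex.norm_real, Real.norm_eq_abs, sq_abs]

/-- Parseval applied to the commutators with single exponentials. Averaged over j, commuting T with
the polynomials costs only the factor η, with no loss in N. -/
theorem sum_norm_sq_commutator_trigPoly_le (a : X d) (N : ℕ) (σ : ℝ) (c : ℕ → ℝ) (T : BddOp d)
    {η : ℝ} (h : ∀ m < N, ‖T * expQ ((m : ℝ) • a) - expQ ((m : ℝ) • a) * T‖ ≤ η) (u : L2 d) :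
    ∑ j ∈ Finset.range N,
      ‖T (mulOp (trigPoly a N σ c j) u) - mulOp (trigPoly a N σ c j) (T u)‖ ^ 2 ≤
      N * (∑ m ∈ Finset.range N, c m ^ 2) * (η * ‖u‖) ^ 2 := by
  have h1 := sum_norm_sq_rotatedRoot N σ fun m =>
    (c m : ℂ) • (T * expQ ((m : ℝ) • a) - expQ ((m : ℝ) • a) * T) u
  have h2 : ∀ j, T (mulOp (trigPoly a N σ c j) u) - mulOp (trigPoly a N σ c j) (T u) =
      ∑ m ∈ Finset.range N, rotatedRoot N σ j ^ m •
        (c m : ℂ) • (T * expQ ((m : ℝ) • a) - expQ ((m : ℝ) • a) * T) u := fun j => by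
    simp only [mulOp_trigPoly, sum_apply, smul_apply, map_sum, map_smul,
      ← Finset.sum_sub_distrib, ← smul_sub, sub_apply, mul_apply_eq_comp]
  simp_rw [h2]
  rw [h1, mul_assoc, Finset.sum_mul]
  refine mul_le_mul_of_nonneg_left (Finset.sum_le_sum fun m hm => ?_) (Nat.cast_nonneg _)
  rw [norm_smul, mul_pow, Complex.norm_real, Real.norm_eq_abs, sq_abs]
  gcongr
  exact ContinuousLinearMap.le_of_opNorm_le _ (h m (Finset.mem_range.1 hm)) u

/-- Multiplying by `rotatedExp - 1` replaces tent coefficients by their increments, of size at most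
1. On average the j-th piece thus sits where `rotatedExp` is close to 1. -/
theorem sum_norm_sq_sub_one_trigPoly_le (a : X d) (N : ℕ) (σ : ℝ) (u : L2 d) :
    ∑ j ∈ Finset.range N,
      ‖mulOp (rotatedExp a N σ j - 1) (mulOp (trigPoly a N σ (tent N) j) u)‖ ^ 2 ≤
      N * N * ‖u‖ ^ 2 := by
  have h1 : ∀ j, ‖mulOp (rotatedExp a N σ j - 1) (mulOp (trigPoly a N σ (tent N) j) u)‖ ≤
      ‖mulOp (trigPoly a N σ (fun m => tent N m - tent N (m + 1)) j) u‖ := fun j => by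
    have h2 : (rotatedExp a N σ j - 1) * trigPoly a N σ (tent N) j =
        rotatedExp a N σ j * trigPoly a N σ (fun m => tent N m - tent N (m + 1)) j :=
      sum_pow_telescope _ N (tent N) (by simp [tent]) (by simp [tent])
    rw [← mul_apply_eq_comp, ← mulOp_mul, h2, mulOp_mul, mul_apply_eq_comp]
    simpa using norm_mulOp_apply_le (rotatedExp a N σ j)
      (mulOp (trigPoly a N σ (fun m => tent N m - tent N (m + 1)) j) u)
      (fun x => (norm_rotatedExp a N σ j x).le)
  calc _ ≤ ∑ j ∈ Finset.range N,
        ‖mulOp (trigPoly a N σ (fun m => tent N m - tent N (m + 1)) j) u‖ ^ 2 :=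
        Finset.sum_le_sum fun j _ => pow_le_pow_left₀ (norm_nonneg _) (h1 j) 2
    _ = _ := sum_norm_sq_trigPoly _ _ _ _ _
    _ ≤ _ := by gcongr; exact sum_tent_sub_sq_le N

/-- The continuous cutoff `max 0 (1 - |(s x - y) / L|)`. -/
def hatCutoff (s : X d → ℝ) (hs : Continuous s) (y L : ℝ) : X d →ᵇ ℂ :=
  BoundedContinuousFunction.ofNormedAddCommGroup
    (fun x => ((max 0 (1 - |(s x - y) / L|) : ℝ) : ℂ)) (by fun_prop) 1
    (fun x => by
      rw [Complex.norm_real, Real.norm_eq_abs, abs_of_nonneg (le_max_left _ _)]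
      exact max_le zero_le_one (by linarith [abs_nonneg ((s x - y) / L)]))

theorem norm_one_sub_hatCutoff_le (s : X d → ℝ) (hs : Continuous s) (y L : ℝ) (x : X d) :
    ‖(1 - hatCutoff s hs y L) x‖ ≤ |(s x - y) / L| := by
  simp only [hatCutoff, BoundedContinuousFunction.sub_apply, BoundedContinuousFunction.coe_one,
    Pi.one_apply, BoundedContinuousFunction.coe_ofNormedAddCommGroup]
  rw [← Complex.ofReal_one, ← Complex.ofReal_sub, Complex.norm_real, Real.norm_eq_abs, abs_le]
  rcases max_cases 0 (1 - |(s x - y) / L|) with h | h <;> constructor <;>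
    linarith [h.1, h.2, abs_nonneg ((s x - y) / L)]

theorem abs_lt_of_hatCutoff_ne_zero {s : X d → ℝ} {hs : Continuous s} {y L : ℝ} (hL : 0 < L)
    {x : X d} (h : hatCutoff s hs y L x ≠ 0) : |s x - y| < L := by
  by_contra hx
  apply h
  simp only [hatCutoff, BoundedContinuousFunction.coe_ofNormedAddCommGroup]
  rw [max_eq_left, Complex.ofReal_zero]
  rw [abs_div, abs_of_pos hL, sub_nonpos, le_div_iff₀ hL]
  linarith

theorem norm_rotatedExp_sub_one (a : X d) (N : ℕ) (σ : ℝ) (j : ℕ) (x : X d) :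
    ‖(rotatedExp a N σ j - 1) x‖ =
      2 * |Real.sin ((inner ℝ a x - 2 * Real.pi * (j - σ) / N) / 2)| := by
  have h : (rotatedExp a N σ j - 1) x = Complex.exp (Complex.I *
      ((inner ℝ a x - 2 * Real.pi * (j - σ) / N : ℝ) : ℂ)) - 1 := by
    simp only [rotatedExp, rotatedRoot, expFun, BoundedContinuousFunction.sub_apply,
      BoundedContinuousFunction.smul_apply, BoundedContinuousFunction.coe_one,
      Pi.one_apply, BoundedContinuousFunction.coe_ofNormedAddCommGroup, smul_eq_mul,
      ← Complex.exp_add]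
    congr 2
    push_cast
    ring
  rw [h, Complex.norm_exp_I_mul_ofReal_sub_one, Real.norm_eq_abs, abs_mul, abs_two]

theorem norm_add_sq_le_two {E : Type*} [SeminormedAddCommGroup E] (x y : E) :
    ‖x + y‖ ^ 2 ≤ 2 * ‖x‖ ^ 2 + 2 * ‖y‖ ^ 2 := by
  have := norm_add_le x y
  nlinarith [norm_nonneg (x + y), sq_nonneg (‖x‖ - ‖y‖)]

theorem add_add_sq_le_three (x y z : ℝ) :
    (x + y + z) ^ 2 ≤ 3 * x ^ 2 + 3 * y ^ 2 + 3 * z ^ 2 := by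
  nlinarith [sq_nonneg (x - y), sq_nonneg (x - z), sq_nonneg (y - z)]

set_option maxHeartbeats 800000 in
/-- An approximate kernel vector of a `q`-continuous operator may be localized in the direction of
one coordinate, on a scale which depends only on the operator and on the precision. -/
theorem QContinuous.exists_localization_coord {T : BddOp d} (hT : QContinuous T) (i : Fin d)
    {δ : ℝ} (hδ : 0 < δ) :
    ∃ R : ℝ, ∀ (S : Set (X d)) (u : L2 d), Bornology.IsBounded S → SuppIn u S → u ≠ 0 →
      ‖T u‖ ≤ δ * ‖u‖ → ∃ S' ⊆ S, ∃ v : L2 d, v ≠ 0 ∧ SuppIn v S' ∧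
        (∀ x ∈ S', ∀ y ∈ S', |x i - y i| ≤ R) ∧ ‖T v‖ ≤ 4 * δ * ‖v‖ := by
  obtain ⟨r, hr, hcomm⟩ := hT.exists_norm_commutator_le (η := δ / 3) (by positivity)
  have hpi := Real.pi_pos
  -- The unit of length: with it the frequencies m‖a‖, m < N, stay below r, whatever the size of the
  -- support.
  set R₀ : ℝ := 2 * Real.pi / r with hR₀
  have hR₀pos : 0 < R₀ := by positivity
  -- The 9 gives 18/L² ≤ 1/4 and the 13 gives ‖T‖² · 18/L² ≤ δ²/9, since 13² ≥ 9 · 18.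
  set L : ℝ := 9 + 13 * ‖T‖ / δ with hL
  have hLpos : 0 < L := by positivity
  refine ⟨2 * L * R₀, fun S u hS hu hu0 hTu => ?_⟩
  obtain ⟨K, hKpos, hK⟩ := hS.exists_pos_norm_le
  -- M depends on the support, but the final scale 2LR₀ does not.
  obtain ⟨M, hM⟩ := exists_nat_gt (K / R₀)
  have hMpos : (0 : ℝ) < M := lt_of_le_of_lt (by positivity) hM
  have hu_pos : 0 < ‖u‖ := norm_pos_iff.2 hu0
  set N : ℕ := 4 * M with hN
  have hNM : (N : ℝ) = 4 * M := by rw [hN]; push_cast; ring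
  -- The centres j - σ fill [-2M, 2M) while s ranges in [-M, M] on the support. Their distance is at
  -- most 3M, short of the period 4M, so wrap-around cannot bring distant points close to phase 1.
  set σ : ℝ := 2 * M with hσ
  set s : X d → ℝ := fun x => x i / R₀ with hs
  have hscont : Continuous s := by fun_prop
  set a : X d := EuclideanSpace.single i (2 * Real.pi / (N * R₀)) with ha
  have hinner : ∀ x : X d, inner ℝ a x = 2 * Real.pi * s x / N := fun x => by
    rw [ha, EuclideanSpace.inner_single_left, hs]
    simp only [conj_trivial]
    rw [hNM]
    field_simp
  have hsS : ∀ x ∈ S, |s x| ≤ M := fun x hx => by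
    rw [hs]
    simp only
    rw [abs_div, abs_of_pos hR₀pos]
    refine le_trans ?_ hM.le
    gcongr
    have := PiLp.norm_apply_le x i
    rw [Real.norm_eq_abs] at this
    exact this.trans (hK x hx)
  set c := tent N with hc
  set G : ℝ := N * ∑ m ∈ Finset.range N, c m ^ 2 with hG
  have hGle : 8 * (M : ℝ) ^ 4 ≤ G := by
    rw [hG, hNM]
    have := le_sum_tent_sq M
    calc 8 * (M : ℝ) ^ 4 = 4 * M * (2 * (M : ℝ) ^ 3) := by ring
      _ ≤ _ := by gcongr
  have hGpos : 0 < G := lt_of_lt_of_le (by positivity) hGle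
  set φ : ℕ → L2 d := fun j => mulOp (trigPoly a N σ c j) u with hφ
  set χ : ℕ → X d →ᵇ ℂ := fun j => hatCutoff s hscont (j - σ) L with hχ
  set v : ℕ → L2 d := fun j => mulOp (χ j) (φ j) with hv
  set ρ : ℕ → L2 d := fun j => mulOp (1 - χ j) (φ j) with hρ
  have hφvρ : ∀ j, φ j = v j + ρ j := fun j => by
    rw [hv, hρ]
    simp only [mulOp_sub, mulOp_one, sub_apply, one_apply_eq_self]
    abel
  have hφS : ∀ j, SuppIn (φ j) S := fun j => (hu.mulOp _).mono Set.inter_subset_left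
  have hsumφ : ∑ j ∈ Finset.range N, ‖φ j‖ ^ 2 = G * ‖u‖ ^ 2 := sum_norm_sq_trigPoly a N σ c u
  have hsumφT : ∑ j ∈ Finset.range N, ‖mulOp (trigPoly a N σ c j) (T u)‖ ^ 2 = G * ‖T u‖ ^ 2 :=
    sum_norm_sq_trigPoly a N σ c (T u)
  have hsumcomm : ∑ j ∈ Finset.range N, ‖T (φ j) - mulOp (trigPoly a N σ c j) (T u)‖ ^ 2 ≤
      G * (δ / 3 * ‖u‖) ^ 2 := by
    refine sum_norm_sq_commutator_trigPoly_le a N σ c T (fun m hm => hcomm _ ?_) u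
    have hm' : (m : ℝ) < N := by exact_mod_cast hm
    have hNpos : (0 : ℝ) < N := by rw [hNM]; positivity
    rw [ha, norm_smul, PiLp.norm_single, Real.norm_of_nonneg (Nat.cast_nonneg _),
      Real.norm_of_nonneg (by positivity), hR₀]
    calc (m : ℝ) * (2 * Real.pi / (N * (2 * Real.pi / r))) = m / N * r := by field_simp
      _ < 1 * r := by gcongr; rwa [div_lt_one hNpos]
      _ = r := one_mul r
  have hρle : ∀ j ∈ Finset.range N, ‖ρ j‖ ≤
      3 * M / L * ‖mulOp (rotatedExp a N σ j - 1) (φ j)‖ := fun j hj => by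
    refine (hφS j).norm_mulOp_le _ _ _ fun x hx => ?_
    refine (norm_one_sub_hatCutoff_le s hscont (j - σ) L x).trans ?_
    rw [norm_rotatedExp_sub_one, hinner, abs_div, abs_of_pos hLpos]
    have hjN : (j : ℝ) < 4 * M := by
      rw [← hNM]; exact_mod_cast Finset.mem_range.1 hj
    have hj0 : (0 : ℝ) ≤ j := Nat.cast_nonneg j
    have hsx := abs_le.1 (hsS x hx)
    have ht : |s x - (j - σ)| ≤ 3 * M := by
      rw [abs_le, hσ]
      constructor <;> linarith [hsx.1, hsx.2]
    have hy : (2 * Real.pi * s x / N - 2 * Real.pi * (j - σ) / N) / 2 =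
        Real.pi / N * (s x - (j - σ)) := by ring
    have hyabs : |Real.pi / N * (s x - (j - σ))| = Real.pi / (4 * M) * |s x - (j - σ)| := by
      rw [abs_mul, hNM, abs_of_pos (by positivity)]
    have hsin := abs_le_mul_abs_sin (y := Real.pi / N * (s x - (j - σ))) (by
      rw [hyabs]
      calc Real.pi / (4 * M) * |s x - (j - σ)| ≤ Real.pi / (4 * M) * (3 * M) := by gcongr
        _ = 3 * Real.pi / 4 := by field_simp)
    rw [hy]
    rw [hyabs] at hsin
    set w := |Real.sin (Real.pi / N * (s x - (j - σ)))|
    have : |s x - (j - σ)| ≤ 6 * M * w := by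
      have h4 : Real.pi / (4 * M) * |s x - (j - σ)| ≤ Real.pi / (4 * M) * (6 * M * w) := by
        refine hsin.trans_eq ?_
        field_simp
        ring
      exact le_of_mul_le_mul_left h4 (by positivity)
    calc |s x - (j - σ)| / L ≤ 6 * M * w / L := by gcongr
      _ = 3 * M / L * (2 * w) := by ring
  -- The powers of M match: (3M/L)² · (4M)² = (18/L²) · 8M⁴, and 8M⁴ ≤ G. Hence the discarded tails
  -- are small uniformly in the support.
  have hsumρ : ∑ j ∈ Finset.range N, ‖ρ j‖ ^ 2 ≤ 18 / L ^ 2 * (G * ‖u‖ ^ 2) := by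
    calc ∑ j ∈ Finset.range N, ‖ρ j‖ ^ 2 ≤ ∑ j ∈ Finset.range N,
          (3 * M / L) ^ 2 * ‖mulOp (rotatedExp a N σ j - 1) (φ j)‖ ^ 2 := by
          refine Finset.sum_le_sum fun j hj => ?_
          rw [← mul_pow]
          exact pow_le_pow_left₀ (norm_nonneg _) (hρle j hj) 2
      _ ≤ (3 * M / L) ^ 2 * (N * N * ‖u‖ ^ 2) := by
          rw [← Finset.mul_sum]
          gcongr
          exact sum_norm_sq_sub_one_trigPoly_le a N σ u
      _ = 18 / L ^ 2 * (8 * (M : ℝ) ^ 4 * ‖u‖ ^ 2) := by rw [hNM]; field_simp; ring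
      _ ≤ _ := by gcongr
  have hL9 : 9 ≤ L := by
    rw [hL]; linarith [show 0 ≤ 13 * ‖T‖ / δ by positivity]
  have hL18 : 18 / L ^ 2 ≤ 1 / 4 := by
    rw [div_le_div_iff₀ (by positivity) (by norm_num)]
    nlinarith
  have hLT : ‖T‖ ^ 2 * (18 / L ^ 2) ≤ δ ^ 2 / 9 := by
    have h1 : 13 * ‖T‖ ≤ L * δ := by
      rw [hL, add_mul, div_mul_cancel₀ _ hδ.ne']
      linarith [show 0 ≤ 9 * δ by positivity]
    rw [mul_div_assoc', div_le_div_iff₀ (by positivity) (by norm_num)]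
    nlinarith [pow_le_pow_left₀ (by positivity) h1 2, sq_nonneg ‖T‖]
  have hsumv : G * ‖u‖ ^ 2 ≤ 4 * ∑ j ∈ Finset.range N, ‖v j‖ ^ 2 := by
    have h1 : ∑ j ∈ Finset.range N, ‖φ j‖ ^ 2 ≤
        2 * ∑ j ∈ Finset.range N, ‖v j‖ ^ 2 + 2 * ∑ j ∈ Finset.range N, ‖ρ j‖ ^ 2 := by
      rw [Finset.mul_sum, Finset.mul_sum, ← Finset.sum_add_distrib]
      refine Finset.sum_le_sum fun j _ => ?_
      rw [hφvρ j]
      exact norm_add_sq_le_two _ _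
    have h2 : 18 / L ^ 2 * (G * ‖u‖ ^ 2) ≤ 1 / 4 * (G * ‖u‖ ^ 2) := by gcongr
    rw [hsumφ] at h1
    linarith
  -- The contributions of T u, of the commutators and of the tails add up to 3 + 1/3 + 1/3 ≤ 4.
  have hsumTv : ∑ j ∈ Finset.range N, ‖T (v j)‖ ^ 2 ≤ 4 * δ ^ 2 * (G * ‖u‖ ^ 2) := by
    have h1 : ∑ j ∈ Finset.range N, ‖T (v j)‖ ^ 2 ≤
        3 * ∑ j ∈ Finset.range N, ‖mulOp (trigPoly a N σ c j) (T u)‖ ^ 2 +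
        3 * ∑ j ∈ Finset.range N, ‖T (φ j) - mulOp (trigPoly a N σ c j) (T u)‖ ^ 2 +
        3 * (‖T‖ ^ 2 * ∑ j ∈ Finset.range N, ‖ρ j‖ ^ 2) := by
      rw [Finset.mul_sum, Finset.mul_sum, Finset.mul_sum, Finset.mul_sum,
        ← Finset.sum_add_distrib, ← Finset.sum_add_distrib]
      refine Finset.sum_le_sum fun j _ => ?_
      have e1 : T (v j) = mulOp (trigPoly a N σ c j) (T u) +
          (T (φ j) - mulOp (trigPoly a N σ c j) (T u)) - T (ρ j) := by
        rw [hφvρ j, map_add]; abel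
      set A₁ := mulOp (trigPoly a N σ c j) (T u)
      set A₂ := T (φ j) - A₁
      have e2 : ‖T (v j)‖ ≤ ‖A₁‖ + ‖A₂‖ + ‖T‖ * ‖ρ j‖ := by
        rw [e1]
        exact (norm_sub_le _ _).trans (add_le_add (norm_add_le _ _) (T.le_opNorm _))
      calc ‖T (v j)‖ ^ 2 ≤ (‖A₁‖ + ‖A₂‖ + ‖T‖ * ‖ρ j‖) ^ 2 :=
            pow_le_pow_left₀ (norm_nonneg _) e2 2
        _ ≤ 3 * ‖A₁‖ ^ 2 + 3 * ‖A₂‖ ^ 2 + 3 * (‖T‖ * ‖ρ j‖) ^ 2 := add_add_sq_le_three _ _ _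
        _ = _ := by rw [mul_pow]
    rw [hsumφT] at h1
    have h2 : G * ‖T u‖ ^ 2 ≤ G * (δ * ‖u‖) ^ 2 := by gcongr
    have h3 : ‖T‖ ^ 2 * ∑ j ∈ Finset.range N, ‖ρ j‖ ^ 2 ≤ δ ^ 2 / 9 * (G * ‖u‖ ^ 2) :=
      calc _ ≤ ‖T‖ ^ 2 * (18 / L ^ 2 * (G * ‖u‖ ^ 2)) := by gcongr
        _ = ‖T‖ ^ 2 * (18 / L ^ 2) * (G * ‖u‖ ^ 2) := by ring
        _ ≤ _ := by gcongr
    have h4 : 0 ≤ δ ^ 2 * (G * ‖u‖ ^ 2) := by positivity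
    calc _ ≤ 3 * (G * (δ * ‖u‖) ^ 2) + 3 * (G * (δ / 3 * ‖u‖) ^ 2) +
          3 * (δ ^ 2 / 9 * (G * ‖u‖ ^ 2)) := h1.trans (by gcongr)
      _ = 11 / 3 * (δ ^ 2 * (G * ‖u‖ ^ 2)) := by ring
      _ ≤ _ := by linarith
  have hGu : 0 < G * ‖u‖ ^ 2 := by positivity
  -- Pigeonhole: the two sums give Σ‖T v_j‖² ≤ 16δ² Σ‖v_j‖², so some nonzero piece satisfies the
  -- bound.
  obtain ⟨j, hj0, hj⟩ : ∃ j, v j ≠ 0 ∧ ‖T (v j)‖ ≤ 4 * δ * ‖v j‖ := by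
    by_contra! hcon
    have hex : ∃ j ∈ Finset.range N, v j ≠ 0 := by
      by_contra! hall
      rw [Finset.sum_eq_zero fun j hj => by rw [hall j hj, norm_zero]; norm_num] at hsumv
      linarith
    have hlt : ∑ j ∈ Finset.range N, (4 * δ * ‖v j‖) ^ 2 < ∑ j ∈ Finset.range N, ‖T (v j)‖ ^ 2 := by
      refine Finset.sum_lt_sum (fun j _ => ?_) ?_
      · by_cases h0 : v j = 0
        · simp [h0]
        · exact pow_le_pow_left₀ (by positivity) (hcon j h0).le 2
      · obtain ⟨j, hj, h0⟩ := hex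
        exact ⟨j, hj, pow_lt_pow_left₀ (hcon j h0) (by positivity) two_ne_zero⟩
    simp_rw [mul_pow] at hlt
    rw [← Finset.mul_sum] at hlt
    have h5 : 4 * δ ^ 2 * (G * ‖u‖ ^ 2) ≤
        4 * δ ^ 2 * (4 * ∑ j ∈ Finset.range N, ‖v j‖ ^ 2) := by gcongr
    linarith
  refine ⟨S ∩ {x | χ j x ≠ 0}, Set.inter_subset_left, v j, hj0, (hφS j).mulOp _, ?_, hj⟩
  intro x hx y hy
  have h1 := abs_lt_of_hatCutoff_ne_zero hLpos hx.2
  have h2 := abs_lt_of_hatCutoff_ne_zero hLpos hy.2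
  have h3 : x i - y i = ((s x - (j - σ)) - (s y - (j - σ))) * R₀ := by
    rw [hs]; field_simp; ring
  rw [h3, abs_mul, abs_of_pos hR₀pos]
  gcongr
  exact (abs_sub _ _).trans (by linarith)

/-- Coordinates are treated one at a time. Each costs a factor 4 in precision, and since supports
only shrink, the bounds already obtained persist. -/
theorem QContinuous.exists_localization_finset {T : BddOp d} (hT : QContinuous T)
    (t : Finset (Fin d)) {δ : ℝ} (hδ : 0 < δ) :
    ∃ R : ℝ, ∀ (S : Set (X d)) (u : L2 d), Bornology.IsBounded S → SuppIn u S → u ≠ 0 →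
      ‖T u‖ ≤ δ * ‖u‖ → ∃ S' ⊆ S, ∃ v : L2 d, v ≠ 0 ∧ SuppIn v S' ∧
        (∀ x ∈ S', ∀ y ∈ S', ∀ i ∈ t, |x i - y i| ≤ R) ∧ ‖T v‖ ≤ 4 ^ t.card * δ * ‖v‖ := by
  induction t using Finset.induction_on with
  | empty => exact ⟨0, fun S u _ hu hu0 hTu => ⟨S, subset_rfl, u, hu0, hu, by simp, by simpa⟩⟩
  | insert i t hi ih =>
    obtain ⟨R₁, h₁⟩ := ih
    obtain ⟨R₂, h₂⟩ := hT.exists_localization_coord i (δ := 4 ^ t.card * δ) (by positivity)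
    refine ⟨max R₁ R₂, fun S u hS hu hu0 hTu => ?_⟩
    obtain ⟨S₁, hS₁, v₁, hv₁, hv₁S, hR₁, hT₁⟩ := h₁ S u hS hu hu0 hTu
    obtain ⟨S₂, hS₂, v₂, hv₂, hv₂S, hR₂, hT₂⟩ := h₂ S₁ v₁ (hS.subset hS₁) hv₁S hv₁ hT₁
    refine ⟨S₂, hS₂.trans hS₁, v₂, hv₂, hv₂S, fun x hx y hy k hk => ?_, ?_⟩
    · rcases Finset.mem_insert.1 hk with rfl | hk
      · exact (hR₂ x hx y hy).trans (le_max_right _ _)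
      · exact (hR₁ x (hS₂ hx) y (hS₂ hy) k hk).trans (le_max_left _ _)
    · rw [Finset.card_insert_of_notMem hi, pow_succ']
      simpa only [mul_assoc] using hT₂

/-- Approximate kernel vectors of a `q`-continuous operator may be localized in sets whose diameter
depends only on the operator and on the precision. -/
theorem QContinuous.exists_localization {T : BddOp d} (hT : QContinuous T) {δ : ℝ} (hδ : 0 < δ) :
    ∃ R : ℝ, ∀ (S : Set (X d)) (u : L2 d), Bornology.IsBounded S → SuppIn u S → u ≠ 0 →
      ‖T u‖ ≤ δ * ‖u‖ → ∃ S' ⊆ S, ∃ v : L2 d, v ≠ 0 ∧ SuppIn v S' ∧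
        (∀ x ∈ S', ∀ y ∈ S', dist y x ≤ R) ∧ ‖T v‖ ≤ 4 ^ d * δ * ‖v‖ := by
  obtain ⟨R, h⟩ := hT.exists_localization_finset Finset.univ hδ
  refine ⟨√(d * R ^ 2), fun S u hS hu hu0 hTu => ?_⟩
  obtain ⟨S', hS', v, hv, hvS, hR, hTv⟩ := h S u hS hu hu0 hTu
  refine ⟨S', hS', v, hv, hvS, fun x hx y hy => ?_, by simpa using hTv⟩
  rw [EuclideanSpace.dist_eq]
  refine Real.sqrt_le_sqrt ?_
  calc ∑ i, dist (y i) (x i) ^ 2 ≤ ∑ _i : Fin d, R ^ 2 := by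
        refine Finset.sum_le_sum fun i _ => ?_
        exact pow_le_pow_left₀ dist_nonneg (hR y hy x hx i (Finset.mem_univ i)) 2
    _ = d * R ^ 2 := by simp

/-- Successive localizations on the scales attached to the precisions `δ k`. -/
theorem QContinuous.exists_nested_localization {T : BddOp d} (hT : QContinuous T) (δ : ℕ → ℝ)
    (hδ : ∀ k, 0 < δ k) (hδ' : ∀ k, 4 ^ d * δ (k + 1) ≤ δ k) :
    ∃ R : ℕ → ℝ, ∀ (n : ℕ) (S : Set (X d)) (u : L2 d), Bornology.IsBounded S → SuppIn u S →
      u ≠ 0 → ‖T u‖ ≤ δ n * ‖u‖ → ∃ x ∈ S, ∀ k ≤ n, ∃ v : L2 d, v ≠ 0 ∧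
        SuppIn v (Metric.closedBall x (R k)) ∧ ‖T v‖ ≤ 4 ^ d * δ k * ‖v‖ := by
  choose R hR using fun k => hT.exists_localization (hδ k)
  refine ⟨R, fun n => ?_⟩
  induction n with
  | zero =>
    intro S u hS hu hu0 hTu
    obtain ⟨S', hS', v, hv, hvS, hd, hTv⟩ := hR 0 S u hS hu hu0 hTu
    obtain ⟨x, hx⟩ := hvS.nonempty hv
    refine ⟨x, hS' hx, fun k hk => ?_⟩
    obtain rfl : k = 0 := by omega
    exact ⟨v, hv, hvS.mono fun y hy => hd x hx y hy, hTv⟩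
  | succ n ih =>
    intro S u hS hu hu0 hTu
    -- The finest precision is treated first. The resulting v is still precise enough for level n,
    -- and the centre found later lies in S', hence close to the whole support of v.
    obtain ⟨S', hS', v, hv, hvS, hd, hTv⟩ := hR (n + 1) S u hS hu hu0 hTu
    obtain ⟨x, hx, hk⟩ := ih S' v (hS.subset hS') hvS hv
      (hTv.trans (mul_le_mul_of_nonneg_right (hδ' n) (norm_nonneg _)))
    refine ⟨x, hS' hx, fun k hkn => ?_⟩
    rcases Nat.le_succ_iff.1 hkn with h | rfl
    · exact hk k h
    · exact ⟨v, hv, hvS.mono fun y hy => hd x hx y hy, hTv⟩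

end Localization

/-! ### Approximation by step functions, and decay of tails. -/

section Step

variable {d : ℕ}

theorem volume_box (s : Fin d → Set ℝ) (hs : ∀ i, MeasurableSet (s i)) :
    volume {x : X d | ∀ i, x i ∈ s i} = ∏ i, volume (s i) := by
  have h := (PiLp.volume_preserving_ofLp (Fin d)).measure_preimage
    (MeasurableSet.univ_pi hs).nullMeasurableSet
  rw [volume_pi_pi] at h
  rw [← h]
  congr 1
  ext x
  simp

/-- The index of the cube of side `h` which contains `x`. -/
def cellIdx (h : ℝ) (x : X d) : Fin d → ℤ := fun i => ⌊x i / h⌋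

theorem measurable_cellIdx (h : ℝ) : Measurable (cellIdx h : X d → Fin d → ℤ) := by
  refine measurable_pi_iff.2 fun i => ?_
  have : Measurable fun x : X d => x i / h := by fun_prop
  exact Int.measurable_floor.comp this

/-- The corner of smallest coordinates of a cube of side `h`. -/
def cellBase (h : ℝ) (j : Fin d → ℤ) : X d := WithLp.toLp 2 fun i => h * j i

theorem measurableSet_cell (h : ℝ) (j : Fin d → ℤ) :
    MeasurableSet (cellIdx h ⁻¹' {j} : Set (X d)) :=
  measurable_cellIdx h (measurableSet_singleton j)

theorem cell_eq_box {h : ℝ} (hh : 0 < h) (j : Fin d → ℤ) :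
    (cellIdx h ⁻¹' {j} : Set (X d)) = {x | ∀ i, x i ∈ Set.Ico (h * j i) (h * (j i + 1))} := by
  ext x
  simp only [Set.mem_preimage, Set.mem_singleton_iff, funext_iff, cellIdx, Int.floor_eq_iff,
    Set.mem_ofPred_eq, Set.mem_Ico, le_div_iff₀ hh, div_lt_iff₀ hh, mul_comm]

theorem volume_cell {h : ℝ} (hh : 0 < h) (j : Fin d → ℤ) :
    volume (cellIdx h ⁻¹' {j} : Set (X d)) = ENNReal.ofReal h ^ d := by
  rw [cell_eq_box hh, volume_box _ fun i => measurableSet_Ico]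
  simp only [Real.volume_Ico]
  simp [mul_add]

theorem volume_cube {h : ℝ} :
    volume {x : X d | ∀ i, x i ∈ Set.Ioo (-h) h} = 2 ^ d * ENNReal.ofReal h ^ d := by
  rw [volume_box _ fun i => measurableSet_Ioo]
  simp only [Real.volume_Ioo, sub_neg_eq_add, ← two_mul]
  rw [Finset.prod_const, Finset.card_univ, Fintype.card_fin, ENNReal.ofReal_mul (by norm_num),
    mul_pow]
  simp

/-- The normalized indicator function of a cube. -/
def cellVec {h : ℝ} (hh : 0 < h) (j : Fin d → ℤ) : L2 d :=
  indicatorConstLp 2 (measurableSet_cell h j)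
    (by rw [volume_cell hh]; exact ENNReal.pow_ne_top ENNReal.ofReal_ne_top) (1 : ℂ)

/-- The indices of the cubes of a large box. -/
def idxBox (d M : ℕ) : Finset (Fin d → ℤ) := Fintype.piFinset fun _ => Finset.Ico (-(M : ℤ)) M

/-- The space of the functions supported in a large box and constant on the cubes of side `h`. -/
def stepSpace (d : ℕ) {h : ℝ} (hh : 0 < h) (M : ℕ) : Submodule ℂ (L2 d) :=
  Submodule.span ℂ (Set.range fun j : idxBox d M => cellVec hh j.1)

instance {h : ℝ} (hh : 0 < h) (M : ℕ) : FiniteDimensional ℂ (stepSpace d hh M) :=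
  FiniteDimensional.span_of_finite ℂ (Set.finite_range _)

theorem exists_step {h : ℝ} (hh : 0 < h) (M : ℕ) (c : (Fin d → ℤ) → ℂ) :
    ∃ w ∈ stepSpace d hh M,
      ∀ᵐ x, w x = if cellIdx h x ∈ idxBox d M then c (cellIdx h x) else 0 := by
  refine ⟨∑ j ∈ idxBox d M, c j • cellVec hh j, Submodule.sum_mem _ fun j hj =>
    Submodule.smul_mem _ _ (Submodule.subset_span ⟨⟨j, hj⟩, rfl⟩), ?_⟩
  have h1 : ∀ s : Finset (Fin d → ℤ), ∀ᵐ x, (∑ j ∈ s, c j • cellVec hh j : L2 d) x =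
      if cellIdx h x ∈ s then c (cellIdx h x) else 0 := by
    intro s
    induction s using Finset.induction_on with
    | empty =>
      filter_upwards [Lp.coeFn_zero ℂ 2 (volume : Measure (X d))] with x hx
      simp
    | insert j s hj ih =>
      rw [Finset.sum_insert hj]
      filter_upwards [ih, Lp.coeFn_add (c j • cellVec hh j) (∑ j ∈ s, c j • cellVec hh j),
        Lp.coeFn_smul (c j) (cellVec hh j), indicatorConstLp_coeFn (p := 2)
          (hs := measurableSet_cell (d := d) h j) (c := (1 : ℂ))
          (hμs := by rw [volume_cell hh]; exact ENNReal.pow_ne_top ENNReal.ofReal_ne_top)]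
        with x hx h1 h2 h3
      rw [h1, Pi.add_apply, hx, h2, Pi.smul_apply, cellVec, h3]
      by_cases hxj : cellIdx h x = j
      · simp [hxj, hj]
      · simp [hxj, Set.indicator]
  exact h1 _

/-- A function which is almost invariant under small translations is close to the functions which
are constant on small cubes. -/
theorem norm_sub_step_sq_le {h : ℝ} (hh : 0 < h) (M : ℕ) (v : L2 d) {ε : ℝ≥0∞}
    (hv : ∀ a : X d, (∀ i, a i ∈ Set.Ioo (-h) h) → ‖expP a v - v‖ₑ ^ 2 ≤ ε) :
    ‖v - (stepSpace d hh M).starProjection v‖ₑ ^ 2 ≤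
      (∫⁻ x in {x | cellIdx h x ∉ idxBox d M}, ‖v x‖ₑ ^ 2) + 2 ^ d * ε := by
  set E := (stepSpace d hh M).starProjection
  set Q : Set (X d) := cellIdx h ⁻¹' {0} with hQ
  set D : Set (X d) := {x | ∀ i, x i ∈ Set.Ioo (-h) h} with hD
  set V : ℝ≥0∞ := ENNReal.ofReal h ^ d with hV
  have hQV : volume Q = V := volume_cell hh 0
  have hQm : MeasurableSet Q := measurableSet_cell h 0
  have hDV : volume D = 2 ^ d * V := volume_cube
  have hDm : MeasurableSet D := by
    have : D = ⋂ i, {x : X d | x i ∈ Set.Ioo (-h) h} := by ext; simp [hD]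
    rw [this]
    refine MeasurableSet.iInter fun i => ?_
    exact measurableSet_Ioo.preimage (by fun_prop)
  have hV0 : V ≠ 0 := pow_ne_zero _ (by simpa using hh)
  have hVtop : V ≠ ∞ := ENNReal.pow_ne_top ENNReal.ofReal_ne_top
  have hvm : Measurable (v : X d → ℂ) := (Lp.stronglyMeasurable v).measurable
  have hbm : Measurable fun x : X d => cellBase h (cellIdx h x) :=
    (measurable_of_countable (cellBase h : (Fin d → ℤ) → X d)).comp (measurable_cellIdx h)
  have hBm : MeasurableSet {x : X d | cellIdx h x ∉ idxBox d M} :=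
    measurable_cellIdx h (Set.to_countable {j | j ∉ idxBox d M}).measurableSet
  set F : X d → X d → ℝ≥0∞ := fun y x => {x | cellIdx h x ∉ idxBox d M}.indicator
    (fun x => ‖v x‖ₑ ^ 2) x + ‖v x - v (y + cellBase h (cellIdx h x))‖ₑ ^ 2 with hF
  -- The projection does at least as well as the step function sampling v at the offset y in each
  -- cube; averaging over y then replaces cube averages of v.
  have hle : ∀ y, ‖v - E v‖ₑ ^ 2 ≤ ∫⁻ x, F y x := fun y => by
    obtain ⟨w, hw, hwx⟩ := exists_step hh M fun j => v (y + cellBase h j)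
    have h1 : ‖v - E v‖ₑ ≤ ‖v - w‖ₑ := by
      rw [← ofReal_norm, ← ofReal_norm]
      refine ENNReal.ofReal_le_ofReal ?_
      rw [Submodule.starProjection_minimal]
      exact ciInf_le ⟨0, by rintro _ ⟨z, rfl⟩; exact norm_nonneg _⟩
        (⟨w, hw⟩ : stepSpace d hh M)
    calc ‖v - E v‖ₑ ^ 2 ≤ ‖v - w‖ₑ ^ 2 := by gcongr
      _ = ∫⁻ x, ‖(v - w) x‖ₑ ^ 2 := by
        rw [lintegral_enorm_sq, ENNReal.ofReal_pow (norm_nonneg _), ofReal_norm]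
      _ ≤ _ := by
        refine lintegral_mono_ae ?_
        filter_upwards [hwx, Lp.coeFn_sub v w] with x h1 h2
        rw [h2, Pi.sub_apply, h1]
        by_cases hx : cellIdx h x ∈ idxBox d M
        · simp [hF, hx]
        · simp [hF, hx]
  -- Substituting y = a + x - (corner of the cube of x) turns the sample point into x + a. Both
  -- points lie in one cube, which forces a into D, of volume 2^d times that of Q.
  have hinner : ∀ x, ∫⁻ y in Q, F y x ≤ {x | cellIdx h x ∉ idxBox d M}.indicator
      (fun x => ‖v x‖ₑ ^ 2) x * V + ∫⁻ a in D, ‖v (x + a) - v x‖ₑ ^ 2 := fun x => by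
    rw [hF, lintegral_add_left measurable_const, setLIntegral_const, hQV]
    refine add_le_add le_rfl ?_
    rw [← lintegral_indicator hQm, ← lintegral_indicator hDm,
      ← lintegral_add_right_eq_self _ (x - cellBase h (cellIdx h x))]
    refine lintegral_mono fun a => ?_
    by_cases ha : a + (x - cellBase h (cellIdx h x)) ∈ Q
    · have haD : a ∈ D := by
        rw [hQ, cell_eq_box hh] at ha
        intro i
        have h1 := ha i
        have h2 : x i ∈ Set.Ico (h * cellIdx h x i) (h * (cellIdx h x i + 1)) := by
          have : x ∈ (cellIdx h ⁻¹' {cellIdx h x} : Set (X d)) := rfl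
          rw [cell_eq_box hh] at this
          exact this i
        simp only [Pi.zero_apply, Int.cast_zero, mul_zero, zero_add, mul_one, PiLp.add_apply,
          PiLp.sub_apply, cellBase, Set.mem_Ico] at h1 h2
        constructor <;> linarith [h1.1, h1.2, h2.1, h2.2]
      rw [Set.indicator_of_mem ha, Set.indicator_of_mem haD, ← enorm_neg]
      refine le_of_eq ?_
      congr 2
      rw [neg_sub]
      congr 2
      abel
    · rw [Set.indicator_of_notMem ha]
      exact zero_le
  have hFm : Measurable (Function.uncurry F) := by
    refine Measurable.add ?_ ?_
    · exact ((hvm.enorm.pow_const 2).indicator hBm).comp measurable_snd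
    · exact (((hvm.comp measurable_snd).sub (hvm.comp (measurable_fst.add
        (hbm.comp measurable_snd)))).enorm.pow_const 2)
  have hGm : Measurable (Function.uncurry fun x a : X d => ‖v (x + a) - v x‖ₑ ^ 2) :=
    ((hvm.comp (measurable_fst.add measurable_snd)).sub (hvm.comp measurable_fst)).enorm.pow_const 2
  have htot : V * ‖v - E v‖ₑ ^ 2 ≤ V * ((∫⁻ x in {x | cellIdx h x ∉ idxBox d M}, ‖v x‖ₑ ^ 2) +
      2 ^ d * ε) := by
    calc V * ‖v - E v‖ₑ ^ 2 = ∫⁻ _ in Q, ‖v - E v‖ₑ ^ 2 := by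
          rw [setLIntegral_const, hQV, mul_comm]
      _ ≤ ∫⁻ y in Q, ∫⁻ x, F y x := lintegral_mono hle
      _ = ∫⁻ x, ∫⁻ y in Q, F y x := lintegral_lintegral_swap hFm.aemeasurable
      _ ≤ ∫⁻ x, ({x | cellIdx h x ∉ idxBox d M}.indicator (fun x => ‖v x‖ₑ ^ 2) x * V +
          ∫⁻ a in D, ‖v (x + a) - v x‖ₑ ^ 2) := lintegral_mono hinner
      _ = (∫⁻ x in {x | cellIdx h x ∉ idxBox d M}, ‖v x‖ₑ ^ 2) * V +
          ∫⁻ a in D, ∫⁻ x, ‖v (x + a) - v x‖ₑ ^ 2 := by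
          rw [lintegral_add_left (((hvm.enorm.pow_const 2).indicator hBm).mul_const V),
            lintegral_mul_const _ ((hvm.enorm.pow_const 2).indicator hBm),
            lintegral_indicator hBm, lintegral_lintegral_swap hGm.aemeasurable]
      _ ≤ (∫⁻ x in {x | cellIdx h x ∉ idxBox d M}, ‖v x‖ₑ ^ 2) * V + ∫⁻ _ in D, ε := by
          refine add_le_add le_rfl ?_
          refine setLIntegral_mono' hDm fun a ha => ?_
          refine le_trans (le_of_eq ?_) (hv a ha)
          rw [← ofReal_norm, ← ENNReal.ofReal_pow (norm_nonneg _), ← lintegral_enorm_sq]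
          refine lintegral_congr_ae ?_
          filter_upwards [Lp.coeFn_sub (expP a v) v, expP_apply_ae a v] with x h1 h2
          rw [h1, Pi.sub_apply, h2]
      _ = _ := by rw [setLIntegral_const, hDV]; ring
  exact (ENNReal.mul_le_mul_iff_right hV0 hVtop).1 htot

/-- A function which is almost invariant under `e^{itq_i}` for small `t` has small tails. -/
theorem setLIntegral_tail_le (v : L2 d) (i : Fin d) {τ : ℝ} (hτ : 0 < τ) {ε : ℝ≥0∞}
    (hv : ∀ t ∈ Set.Ioc 0 τ, ‖expQ (EuclideanSpace.single i t) v - v‖ₑ ^ 2 ≤ ε) :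
    ∫⁻ x in {x : X d | 2 / τ ≤ |x i|}, ‖v x‖ₑ ^ 2 ≤ ε := by
  have hvm : Measurable (v : X d → ℂ) := (Lp.stronglyMeasurable v).measurable
  set T : Set (X d) := {x : X d | 2 / τ ≤ |x i|} with hT
  have hTm : MeasurableSet T := measurableSet_le measurable_const (by fun_prop)
  set g : ℝ → X d → ℝ≥0∞ := fun t x =>
    ENNReal.ofReal (2 - 2 * Real.cos (t * x i)) * ‖v x‖ₑ ^ 2 with hg
  have hgm : Measurable (Function.uncurry g) := by
    refine Measurable.mul ?_ ((hvm.comp measurable_snd).enorm.pow_const 2)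
    have : Continuous fun p : ℝ × X d => 2 - 2 * Real.cos (p.1 * p.2 i) := by fun_prop
    exact this.measurable.ennreal_ofReal
  have hgt : ∀ t, ∫⁻ x, g t x = ‖expQ (EuclideanSpace.single i t) v - v‖ₑ ^ 2 := fun t => by
    rw [← ofReal_norm, ← ENNReal.ofReal_pow (norm_nonneg _), ← lintegral_enorm_sq]
    refine lintegral_congr_ae ?_
    filter_upwards [Lp.coeFn_sub (expQ (EuclideanSpace.single i t) v) v,
      expQ_apply_ae (EuclideanSpace.single i t) v] with x h1 h2
    rw [h1, Pi.sub_apply, h2, EuclideanSpace.inner_single_left, conj_trivial,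
      show ∀ z w : ℂ, z * w - w = (z - 1) * w from fun z w => by ring, enorm_mul, mul_pow, hg]
    rw [← ofReal_norm, ← ENNReal.ofReal_pow (norm_nonneg _),
      Complex.norm_exp_I_mul_ofReal_sub_one, Real.norm_eq_abs, sq_abs]
    rw [mul_pow, Real.sin_sq_eq_half_sub, mul_div_cancel₀ _ (two_ne_zero)]
    ring_nf
  -- The mean over t of |e^{itx_i} - 1|² = 2 - 2cos(t x_i) is 2 - 2 sin(τx_i)/(τx_i), at least 1
  -- once τ|x_i| ≥ 2.
  have hx : ∀ x ∈ T, ENNReal.ofReal τ * ‖v x‖ₑ ^ 2 ≤ ∫⁻ t in Set.Ioc 0 τ, g t x := fun x hx => by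
    have hxT : 2 / τ ≤ |x i| := hx
    have hx0 : 0 < |x i| := lt_of_lt_of_le (by positivity) hxT
    have hcont : Continuous fun t : ℝ => 2 - 2 * Real.cos (t * x i) := by fun_prop
    rw [hg, lintegral_mul_const _ hcont.measurable.ennreal_ofReal]
    gcongr
    rw [← ofReal_integral_eq_lintegral_ofReal]
    · refine ENNReal.ofReal_le_ofReal ?_
      rw [← intervalIntegral.integral_of_le hτ.le, intervalIntegral.integral_sub (by simp)
        (Continuous.intervalIntegrable (by fun_prop) _ _), intervalIntegral.integral_const_mul,
        intervalIntegral.integral_comp_mul_right _ (abs_pos.1 hx0), integral_cos]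
      simp only [intervalIntegral.integral_const, sub_zero, smul_eq_mul, zero_mul, Real.sin_zero]
      have h1 : (x i)⁻¹ * Real.sin (τ * x i) ≤ τ / 2 := by
        calc (x i)⁻¹ * Real.sin (τ * x i) ≤ |(x i)⁻¹ * Real.sin (τ * x i)| := le_abs_self _
          _ = |x i|⁻¹ * |Real.sin (τ * x i)| := by rw [abs_mul, abs_inv]
          _ ≤ |x i|⁻¹ * 1 := by gcongr; exact Real.abs_sin_le_one _
          _ ≤ (2 / τ)⁻¹ * 1 := by gcongr
          _ = τ / 2 := by rw [inv_div, mul_one]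
      linarith
    · exact hcont.integrableOn_Ioc
    · exact Eventually.of_forall fun t => by
        have := Real.cos_le_one (t * x i)
        simp only [Pi.zero_apply]
        linarith
  have htot : ENNReal.ofReal τ * ∫⁻ x in T, ‖v x‖ₑ ^ 2 ≤ ENNReal.ofReal τ * ε := by
    calc _ = ∫⁻ x in T, ENNReal.ofReal τ * ‖v x‖ₑ ^ 2 :=
          (lintegral_const_mul _ (hvm.enorm.pow_const 2)).symm
      _ ≤ ∫⁻ x in T, ∫⁻ t in Set.Ioc 0 τ, g t x := setLIntegral_mono' hTm hx
      _ ≤ ∫⁻ x, ∫⁻ t in Set.Ioc 0 τ, g t x := setLIntegral_le_lintegral _ _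
      _ = ∫⁻ t in Set.Ioc 0 τ, ∫⁻ x, g t x := (lintegral_lintegral_swap hgm.aemeasurable).symm
      _ ≤ ∫⁻ _ in Set.Ioc 0 τ, ε := by
          refine setLIntegral_mono' measurableSet_Ioc fun t ht => ?_
          rw [hgt]
          exact hv t ht
      _ = _ := by rw [setLIntegral_const, Real.volume_Ioc, sub_zero, mul_comm]
  exact (ENNReal.mul_le_mul_iff_right (by simpa using hτ) ENNReal.ofReal_ne_top).1 htot

end Step

/-! ### Uniform finite rank approximation. -/

section Compactness

variable {d : ℕ}

theorem enorm_sq_le_ofReal {u : L2 d} {c : ℝ} (h : ‖u‖ ≤ c) :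
    ‖u‖ₑ ^ 2 ≤ ENNReal.ofReal (c ^ 2) := by
  rw [← ofReal_norm, ← ENNReal.ofReal_pow (norm_nonneg _)]
  exact ENNReal.ofReal_le_ofReal (pow_le_pow_left₀ (norm_nonneg _) h 2)

/-- A uniform version of the Kolmogorov-Riesz criterion: operators whose ranges are equicontinuous
in position and in momentum are uniformly approximated by finite rank operators. -/
theorem exists_uniform_finiteRank_approx {ι : Type*} (T : ι → BddOp d)
    (hP : ∀ ε > 0, ∃ r > 0, ∀ j, ∀ a : X d, ‖a‖ < r → ‖(expP a - 1) * T j‖ ≤ ε)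
    (hQ : ∀ ε > 0, ∃ r > 0, ∀ j, ∀ a : X d, ‖a‖ < r → ‖(expQ a - 1) * T j‖ ≤ ε)
    {ε : ℝ} (hε : 0 < ε) :
    ∃ W : Submodule ℂ (L2 d), ∃ _ : FiniteDimensional ℂ W,
      ∀ j, ‖T j - W.starProjection * T j‖ ≤ ε := by
  -- The squared error is at most dη² from the tails, one term per coordinate, plus 2^d η² from the
  -- cubes.
  set η : ℝ := ε / √(d + 2 ^ d) with hη
  have hsq : 0 < √((d : ℝ) + 2 ^ d) := Real.sqrt_pos.2 (by positivity)
  have hηpos : 0 < η := by positivity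
  obtain ⟨r, hr, hrP⟩ := hP η hηpos
  obtain ⟨r', hr', hrQ⟩ := hQ η hηpos
  set h : ℝ := r / (d + 1) with hh
  have hhpos : 0 < h := by positivity
  set τ : ℝ := r' / 2 with hτ
  have hτpos : 0 < τ := by positivity
  obtain ⟨M, hM⟩ := exists_nat_gt (2 / τ / h)
  rw [div_lt_iff₀ hhpos] at hM
  refine ⟨stepSpace d hhpos M, inferInstance, fun j => ?_⟩
  refine ContinuousLinearMap.opNorm_le_bound _ hε.le fun u => ?_
  set v := T j u with hv
  have hvP : ∀ a : X d, ‖a‖ < r → ‖expP a v - v‖ ≤ η * ‖u‖ := fun a ha => by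
    simpa using ContinuousLinearMap.le_of_opNorm_le _ (hrP j a ha) u
  have hvQ : ∀ a : X d, ‖a‖ < r' → ‖expQ a v - v‖ ≤ η * ‖u‖ := fun a ha => by
    simpa using ContinuousLinearMap.le_of_opNorm_le _ (hrQ j a ha) u
  have h1 := norm_sub_step_sq_le hhpos M v (ε := ENNReal.ofReal ((η * ‖u‖) ^ 2)) fun a ha => by
    refine enorm_sq_le_ofReal (hvP a ?_)
    calc ‖a‖ ≤ ∑ i, ‖a i‖ := by
          conv_lhs => rw [← (EuclideanSpace.basisFun (Fin d) ℝ).sum_repr a]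
          refine (norm_sum_le _ _).trans_eq (Finset.sum_congr rfl fun i _ => ?_)
          rw [norm_smul]
          simp
      _ ≤ ∑ _i : Fin d, h := Finset.sum_le_sum fun i _ => (abs_lt.2 (ha i)).le
      _ = d * h := by simp
      _ < (d + 1) * h := by gcongr; linarith
      _ = r := by rw [hh]; field_simp
  have h2 : ∀ i, ∫⁻ x in {x : X d | 2 / τ ≤ |x i|}, ‖v x‖ₑ ^ 2 ≤
      ENNReal.ofReal ((η * ‖u‖) ^ 2) := fun i => by
    refine setLIntegral_tail_le v i hτpos fun t ht => enorm_sq_le_ofReal (hvQ _ ?_)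
    rw [PiLp.norm_single, Real.norm_of_nonneg ht.1.le]
    linarith [ht.2]
  have h3 : ∫⁻ x in {x : X d | cellIdx h x ∉ idxBox d M}, ‖v x‖ₑ ^ 2 ≤
      d * ENNReal.ofReal ((η * ‖u‖) ^ 2) := by
    calc _ ≤ ∫⁻ x in ⋃ i, {x : X d | 2 / τ ≤ |x i|}, ‖v x‖ₑ ^ 2 := by
          refine lintegral_mono_set fun x hx => ?_
          simp only [idxBox, Fintype.mem_piFinset, Finset.mem_Ico, not_forall, cellIdx,
            Set.mem_ofPred_eq] at hx
          obtain ⟨i, hi⟩ := hx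
          refine Set.mem_iUnion.2 ⟨i, ?_⟩
          by_contra hlt
          simp only [Set.mem_ofPred_eq, not_le] at hlt
          have hlt' := abs_lt.1 (hlt.trans hM)
          apply hi
          rw [Int.le_floor, Int.floor_lt, le_div_iff₀ hhpos, div_lt_iff₀ hhpos]
          push_cast
          constructor <;> linarith [hlt'.1, hlt'.2]
      _ ≤ ∑' i, ∫⁻ x in {x : X d | 2 / τ ≤ |x i|}, ‖v x‖ₑ ^ 2 := lintegral_iUnion_le _ _
      _ ≤ ∑' _i : Fin d, ENNReal.ofReal ((η * ‖u‖) ^ 2) := ENNReal.tsum_le_tsum h2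
      _ = _ := by rw [tsum_fintype]; simp
  have h4 : ‖v - (stepSpace d hhpos M).starProjection v‖ₑ ^ 2 ≤
      ENNReal.ofReal ((ε * ‖u‖) ^ 2) := by
    refine (h1.trans (add_le_add h3 le_rfl)).trans_eq ?_
    have h5 : ((ε * ‖u‖) ^ 2) = (d + 2 ^ d) * (η * ‖u‖) ^ 2 := by
      rw [hη, mul_pow, mul_pow, div_pow, Real.sq_sqrt (by positivity)]
      field_simp
    rw [h5, ENNReal.ofReal_mul (by positivity),
      ENNReal.ofReal_add (Nat.cast_nonneg d) (by positivity),
      add_mul, ENNReal.ofReal_natCast, ENNReal.ofReal_pow (show (0 : ℝ) ≤ 2 by norm_num)]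
    simp
  rw [← ofReal_norm, ← ENNReal.ofReal_pow (norm_nonneg _),
    ENNReal.ofReal_le_ofReal_iff (by positivity)] at h4
  have h6 := abs_le_of_sq_le_sq h4 (by positivity)
  rw [abs_norm] at h6
  simpa [hv] using h6

theorem expP_mul_mulOp (a : X d) (f : X d →ᵇ ℂ) :
    expP a * mulOp f = mulOp (f.compContinuous ⟨fun x => x + a, by fun_prop⟩) * expP a := by
  ext u
  simp only [mul_apply_eq_comp]
  filter_upwards [expP_apply_ae a (mulOp f u), ae_add_right a (mulOp_apply_ae f u),
    expP_apply_ae a u, mulOp_apply_ae (f.compContinuous ⟨fun x => x + a, by fun_prop⟩)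
      (expP a u)] with x h1 h2 h3 h4
  rw [h1, h2, h4, h3]
  rfl

/-- Moving `expP a` past θ replaces θ by θ(· + a), uniformly close to θ. The radius does not depend
on B, so the bound is uniform over translates. -/
theorem exists_norm_expP_sub_one_mul_mulOp_le (θ : C₀(X d, ℂ)) {ε : ℝ} (hε : 0 < ε) :
    ∃ r > 0, ∀ a : X d, ‖a‖ < r → ∀ B : BddOp d,
      ‖(expP a - 1) * (mulOp θ.toBCF * B)‖ ≤ ‖θ‖ * ‖(expP a - 1) * B‖ + ε * ‖B‖ := by
  obtain ⟨r, hr, h⟩ := Metric.uniformContinuous_iff.1 (ZeroAtInftyContinuousMap.uniformContinuous θ)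
    ε hε
  refine ⟨r, hr, fun a ha B => ?_⟩
  set f := θ.toBCF.compContinuous ⟨fun x => x + a, by fun_prop⟩ with hf
  have h1 : (expP a - 1) * (mulOp θ.toBCF * B) =
      mulOp f * ((expP a - 1) * B) + mulOp (f - θ.toBCF) * B := by
    rw [sub_mul, ← mul_assoc, expP_mul_mulOp, mulOp_sub]
    noncomm_ring
  have h2 : ‖mulOp f‖ ≤ ‖θ‖ := norm_mulOp_le_of_le _ (norm_nonneg _) fun x =>
    (θ.toBCF.norm_coe_le_norm (x + a))
  have h3 : ‖mulOp (f - θ.toBCF)‖ ≤ ε := norm_mulOp_le_of_le _ hε.le fun x => by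
    have := h (a := x + a) (b := x) (by simpa [dist_eq_norm] using ha)
    rw [dist_eq_norm] at this
    exact this.le
  rw [h1]
  refine (norm_add_le _ _).trans (add_le_add ?_ ?_)
  · exact (norm_mul_le _ _).trans (mul_le_mul_of_nonneg_right h2 (norm_nonneg _))
  · exact (norm_mul_le _ _).trans (mul_le_mul_of_nonneg_right h3 (norm_nonneg _))

/-- Far away θ is small; on a bounded set |e^{ia·x} - 1| ≤ |a||x|. -/
theorem exists_norm_expQ_sub_one_mul_mulOp_le (θ : C₀(X d, ℂ)) {ε : ℝ} (hε : 0 < ε) :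
    ∃ r > 0, ∀ a : X d, ‖a‖ < r → ‖(expQ a - 1) * mulOp θ.toBCF‖ ≤ ε := by
  have h0 : ∀ᶠ x in cocompact (X d), ‖θ x‖ < ε / 2 := by
    have := (zero_at_infty θ).norm
    rw [norm_zero] at this
    exact this.eventually (gt_mem_nhds (by positivity))
  rw [← Metric.cobounded_eq_cocompact,
    (Metric.hasBasis_cobounded_compl_closedBall 0).eventually_iff] at h0
  obtain ⟨K, -, hK⟩ := h0
  refine ⟨ε / ((‖θ‖ + 1) * (|K| + 1)), by positivity, fun a ha => ?_⟩
  rw [← mulOp_one, expQ, ← mulOp_sub, ← mulOp_mul]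
  refine norm_mulOp_le_of_le _ hε.le fun x => ?_
  rw [BoundedContinuousFunction.mul_apply, norm_mul, BoundedContinuousFunction.sub_apply]
  change ‖expFun a x - 1‖ * ‖θ x‖ ≤ ε
  by_cases hx : ‖x‖ ≤ K
  · have h1 : ‖expFun a x - 1‖ ≤ ‖a‖ * ‖x‖ := by
      simp only [expFun, BoundedContinuousFunction.coe_ofNormedAddCommGroup]
      exact (Real.norm_exp_I_mul_ofReal_sub_one_le).trans (norm_inner_le_norm _ _)
    have h2 : ‖θ x‖ ≤ ‖θ‖ + 1 :=
      (θ.toBCF.norm_coe_le_norm x).trans (le_add_of_nonneg_right zero_le_one)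
    calc ‖expFun a x - 1‖ * ‖θ x‖ ≤ (‖a‖ * ‖x‖) * (‖θ‖ + 1) := by gcongr
      _ ≤ (ε / ((‖θ‖ + 1) * (|K| + 1)) * (|K| + 1)) * (‖θ‖ + 1) := by
          gcongr
          exact (hx.trans (le_abs_self K)).trans (by linarith)
      _ = ε := by field_simp
  · have h1 : ‖expFun a x - 1‖ ≤ 2 := by
      refine (norm_sub_le _ _).trans ?_
      rw [norm_expFun, norm_one]
      norm_num
    have h2 : ‖θ x‖ < ε / 2 := hK (by simpa using hx)
    calc ‖expFun a x - 1‖ * ‖θ x‖ ≤ 2 * (ε / 2) := by gcongr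
      _ = ε := by ring

theorem norm_mulOp_C0_le (θ : C₀(X d, ℂ)) : ‖mulOp θ.toBCF‖ ≤ ‖θ‖ := norm_mulOp_le _

/-- For `A` in the elliptic algebra, the operators `θ(q) τ_x(A)` are uniformly approximated by
finite rank operators. -/
theorem exists_approx_mulOp_translate {A : BddOp d} (hA : A ∈ ellipticAlgebra d) (θ : C₀(X d, ℂ))
    {ε : ℝ} (hε : 0 < ε) :
    ∃ W : Submodule ℂ (L2 d), ∃ _ : FiniteDimensional ℂ W, ∀ x : X d,
      ‖mulOp θ.toBCF * translate x A - W.starProjection * (mulOp θ.toBCF * translate x A)‖ ≤ ε := by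
  refine exists_uniform_finiteRank_approx (fun x => mulOp θ.toBCF * translate x A) ?_ ?_ hε
  · intro ε hε
    obtain ⟨r, hr, h⟩ := exists_norm_expP_sub_one_mul_mulOp_le θ
      (ε := ε / (2 * (‖A‖ + 1))) (by positivity)
    obtain ⟨r', hr', h'⟩ := Metric.eventually_nhds_iff.1
      (hA.1.eventually (gt_mem_nhds (show 0 < ε / (2 * (‖θ‖ + 1)) by positivity)))
    refine ⟨min r r', lt_min hr hr', ?_⟩
    intro x a ha
    refine (h a (ha.trans_le (min_le_left _ _)) _).trans ?_
    have h1 := (h' (y := a) (by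
      rw [dist_zero_right]; exact ha.trans_le (min_le_right _ _))).le
    have h2 : (expP a - 1) * translate x A = translate x ((expP a - 1) * A) := by
      rw [translate_mul, translate_sub, translate_expP, translate_one]
    rw [h2, norm_translate, norm_translate]
    calc _ ≤ ‖θ‖ * (ε / (2 * (‖θ‖ + 1))) + ε / (2 * (‖A‖ + 1)) * ‖A‖ := by gcongr
      _ ≤ (‖θ‖ + 1) * (ε / (2 * (‖θ‖ + 1))) + ε / (2 * (‖A‖ + 1)) * (‖A‖ + 1) := by
          gcongr <;> linarith
      _ = ε := by field_simp; ring
  · intro ε hε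
    obtain ⟨r, hr, h⟩ := exists_norm_expQ_sub_one_mul_mulOp_le θ
      (ε := ε / (‖A‖ + 1)) (by positivity)
    refine ⟨r, hr, ?_⟩
    intro x a ha
    rw [← mul_assoc]
    refine (norm_mul_le _ _).trans ?_
    rw [norm_translate]
    calc _ ≤ ε / (‖A‖ + 1) * (‖A‖ + 1) := by
          gcongr
          · exact h a ha
          · linarith
      _ = ε := by field_simp

/-- For `A` in the elliptic algebra, the operators `τ_x(A) θ(q)` are uniformly approximated by
finite rank operators. -/
theorem exists_approx_translate_mulOp {A : BddOp d} (hA : A ∈ ellipticAlgebra d) (θ : C₀(X d, ℂ))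
    {ε : ℝ} (hε : 0 < ε) :
    ∃ W : Submodule ℂ (L2 d), ∃ _ : FiniteDimensional ℂ W, ∀ x : X d,
      ‖translate x A * mulOp θ.toBCF - W.starProjection * (translate x A * mulOp θ.toBCF)‖ ≤ ε := by
  refine exists_uniform_finiteRank_approx (fun x => translate x A * mulOp θ.toBCF) ?_ ?_ hε
  · intro ε hε
    obtain ⟨r, hr, h⟩ := Metric.eventually_nhds_iff.1
      (hA.1.eventually (gt_mem_nhds (show 0 < ε / (‖θ‖ + 1) by positivity)))
    refine ⟨r, hr, ?_⟩
    intro x a ha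
    have h1 := (h (y := a) (by rwa [dist_zero_right])).le
    have h2 : (expP a - 1) * translate x A = translate x ((expP a - 1) * A) := by
      rw [translate_mul, translate_sub, translate_expP, translate_one]
    rw [← mul_assoc]
    refine (norm_mul_le _ _).trans ?_
    rw [h2, norm_translate]
    calc _ ≤ ε / (‖θ‖ + 1) * (‖θ‖ + 1) := by
          gcongr
          exact (norm_mulOp_C0_le θ).trans (by linarith)
      _ = ε := by field_simp
  · intro ε hε
    obtain ⟨r, hr, h⟩ := exists_norm_expQ_sub_one_mul_mulOp_le θ
      (ε := ε / (2 * (‖A‖ + 1))) (by positivity)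
    obtain ⟨r', hr', h'⟩ := Metric.eventually_nhds_iff.1
      (hA.2.2.eventually (gt_mem_nhds (show 0 < ε / (2 * (‖θ‖ + 1)) by positivity)))
    refine ⟨min r r', lt_min hr hr', ?_⟩
    intro x a ha
    have h1 := (h' (y := a) (by
      rw [dist_zero_right]; exact ha.trans_le (min_le_right _ _))).le
    have h2 : ‖translate x A * expQ a - expQ a * translate x A‖ ≤ ε / (2 * (‖θ‖ + 1)) := by
      rw [norm_commutator_expQ, translate_conj_expQ, ← translate_sub, norm_translate]
      exact h1
    have h3 : (expQ a - 1) * (translate x A * mulOp θ.toBCF) =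
        translate x A * ((expQ a - 1) * mulOp θ.toBCF) -
        (translate x A * expQ a - expQ a * translate x A) * mulOp θ.toBCF := by
      noncomm_ring
    rw [h3]
    refine (norm_sub_le _ _).trans ((add_le_add (norm_mul_le _ _) (norm_mul_le _ _)).trans ?_)
    rw [norm_translate]
    calc _ ≤ (‖A‖ + 1) * (ε / (2 * (‖A‖ + 1))) + ε / (2 * (‖θ‖ + 1)) * (‖θ‖ + 1) := by
          gcongr
          · linarith
          · exact h a (ha.trans_le (min_le_left _ _))
          · exact (norm_mulOp_C0_le θ).trans (by linarith)
      _ = ε := by field_simp; ring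

end Compactness

/-! ### Limits of translates along ultrafilters. -/

section Limits

variable {d : ℕ}

theorem localNormTendsto_iff {ι : Type*} {F : ι → BddOp d} {l : Filter ι} {B : BddOp d} :
    LocalNormTendsto F l B ↔
      ∀ θ : C₀(X d, ℂ), Tendsto (fun i => ‖(F i - B) * mulOp θ.toBCF‖) l (𝓝 0) := by
  have h := @WithSeminorms.tendsto_nhds ℂ (BddOp d) ι C₀(X d, ℂ) _ _ _ (localNormTopology d)
    localSeminorm (WithSeminorms.mk (topology := localNormTopology d) rfl) F l B
  rw [LocalNormTendsto, h]
  refine forall_congr' fun θ => ?_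
  rw [Metric.tendsto_nhds]
  refine forall_congr' fun ε => forall_congr' fun _ => ?_
  simp only [dist_zero_right, norm_norm]
  rfl

theorem exists_tendsto_of_approx {ι E : Type*} [NormedAddCommGroup E] [CompleteSpace E]
    {F : ι → E} {l : Filter ι} [l.NeBot]
    (h : ∀ ε > 0, ∃ G : ι → E, (∃ g, Tendsto G l (𝓝 g)) ∧ ∀ i, ‖F i - G i‖ ≤ ε) :
    ∃ f, Tendsto F l (𝓝 f) := by
  rw [← cauchy_map_iff_exists_tendsto, Metric.cauchy_iff]
  refine ⟨inferInstance, fun ε hε => ?_⟩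
  obtain ⟨G, ⟨g, hg⟩, hFG⟩ := h (ε / 5) (by positivity)
  refine ⟨F '' (G ⁻¹' Metric.ball g (ε / 5)), image_mem_map (hg (Metric.ball_mem_nhds g (by
    positivity))), ?_⟩
  rintro _ ⟨i, hi, rfl⟩ _ ⟨j, hj, rfl⟩
  have h1 : dist (F i) (G i) ≤ ε / 5 := by rw [dist_eq_norm]; exact hFG i
  have h2 : dist (G j) (F j) ≤ ε / 5 := by rw [dist_comm, dist_eq_norm]; exact hFG j
  have h3 : dist (G i) g < ε / 5 := hi
  have h4 : dist g (G j) < ε / 5 := by rw [dist_comm]; exact hj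
  have h5 := dist_triangle4 (F i) (G i) g (F j)
  have h6 := dist_triangle g (G j) (F j)
  linarith

/-- A radial cutoff function: `1` on the ball of radius `R`, `0` outside the ball of radius
`R + 1`. -/
def cutoff (d : ℕ) (R : ℝ) : C₀(X d, ℂ) where
  toFun x := ((max 0 (min 1 (R + 1 - ‖x‖)) : ℝ) : ℂ)
  continuous_toFun := by fun_prop
  zero_at_infty' := by
    refine tendsto_const_nhds.congr' ?_
    rw [← Metric.cobounded_eq_cocompact]
    have : ∀ᶠ x : X d in Bornology.cobounded (X d), R + 1 ≤ ‖x‖ :=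
      tendsto_norm_cobounded_atTop.eventually_ge_atTop (R + 1)
    filter_upwards [this] with x hx
    rw [max_eq_left, Complex.ofReal_zero]
    exact (min_le_right _ _).trans (by linarith)

theorem cutoff_eq_one {R : ℝ} {x : X d} (hx : ‖x‖ ≤ R) : (cutoff d R).toBCF x = 1 := by
  change ((max 0 (min 1 (R + 1 - ‖x‖)) : ℝ) : ℂ) = 1
  rw [min_eq_left (by linarith), max_eq_right zero_le_one, Complex.ofReal_one]

theorem norm_lt_of_cutoff_ne_zero {R : ℝ} {x : X d} (hx : (cutoff d R).toBCF x ≠ 0) :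
    ‖x‖ < R + 1 := by
  by_contra h
  apply hx
  change ((max 0 (min 1 (R + 1 - ‖x‖)) : ℝ) : ℂ) = 0
  rw [max_eq_left, Complex.ofReal_zero]
  exact (min_le_right _ _).trans (by linarith)

theorem norm_one_sub_cutoff_le (R : ℝ) (x : X d) :
    ‖(1 - (cutoff d R).toBCF : X d →ᵇ ℂ) x‖ ≤ 1 := by
  change ‖(1 : ℂ) - ((max 0 (min 1 (R + 1 - ‖x‖)) : ℝ) : ℂ)‖ ≤ 1
  rw [← Complex.ofReal_one, ← Complex.ofReal_sub, Complex.norm_real, Real.norm_eq_abs, abs_le]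
  have h1 : max 0 (min 1 (R + 1 - ‖x‖)) ≤ 1 := max_le zero_le_one (min_le_left _ _)
  have h2 : 0 ≤ max 0 (min 1 (R + 1 - ‖x‖)) := le_max_left _ _
  constructor <;> linarith

theorem norm_cutoff_le (R : ℝ) : ‖mulOp (cutoff d R).toBCF‖ ≤ 1 := by
  refine norm_mulOp_le_of_le _ zero_le_one fun x => ?_
  change ‖((max 0 (min 1 (R + 1 - ‖x‖)) : ℝ) : ℂ)‖ ≤ 1
  rw [Complex.norm_real, Real.norm_of_nonneg (le_max_left _ _)]
  exact max_le zero_le_one (min_le_left _ _)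

theorem tendsto_cutoff_apply (u : L2 d) :
    Tendsto (fun R : ℝ => ‖mulOp (1 - (cutoff d R).toBCF) u‖) atTop (𝓝 0) := by
  have h : Tendsto (fun R : ℝ => ‖mulOp (1 - (cutoff d R).toBCF) u‖ ^ 2) atTop (𝓝 0) := by
    have h1 : ∀ R : ℝ, ‖mulOp (1 - (cutoff d R).toBCF) u‖ ^ 2 =
        ∫ x, ‖(1 - (cutoff d R).toBCF : X d →ᵇ ℂ) x‖ ^ 2 * ‖u x‖ ^ 2 := fun R => by
      rw [norm_sq_eq_integral]
      refine integral_congr_ae ?_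
      filter_upwards [mulOp_apply_ae (1 - (cutoff d R).toBCF) u] with x hx
      rw [hx, norm_mul, mul_pow]
    simp_rw [h1]
    rw [← integral_zero (X d) ℝ (μ := volume)]
    refine tendsto_integral_filter_of_dominated_convergence (fun x => ‖u x‖ ^ 2) ?_ ?_
      (integrable_norm_sq u) ?_
    · refine Eventually.of_forall fun R => AEStronglyMeasurable.mul ?_
        (integrable_norm_sq u).aestronglyMeasurable
      exact ((BoundedContinuousFunction.continuous _).norm.pow 2).aestronglyMeasurable
    · refine Eventually.of_forall fun R => Eventually.of_forall fun x => ?_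
      rw [Real.norm_of_nonneg (by positivity)]
      exact mul_le_of_le_one_left (by positivity)
        (pow_le_one₀ (norm_nonneg _) (norm_one_sub_cutoff_le R x))
    · refine Eventually.of_forall fun x => tendsto_const_nhds.congr' ?_
      filter_upwards [eventually_ge_atTop ‖x‖] with R hR
      rw [BoundedContinuousFunction.sub_apply, cutoff_eq_one hR]
      simp
  have h2 := h.sqrt
  rw [Real.sqrt_zero] at h2
  exact h2.congr fun R => Real.sqrt_sq (norm_nonneg _)

theorem exists_norm_sub_cutoff_lt (u : L2 d) {ε : ℝ} (hε : 0 < ε) :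
    ∃ R : ℝ, ‖u - mulOp (cutoff d R).toBCF u‖ < ε := by
  obtain ⟨R, hR⟩ := ((tendsto_cutoff_apply u).eventually (gt_mem_nhds hε)).exists
  refine ⟨R, ?_⟩
  rwa [mulOp_sub, mulOp_one, sub_apply, one_apply_eq_self] at hR

/-- On bounded families, convergence in the local norm topology implies strong convergence. -/
theorem LocalNormTendsto.tendsto_apply {ι : Type*} {F : ι → BddOp d} {l : Filter ι} {B : BddOp d}
    (h : LocalNormTendsto F l B) {C : ℝ} (hC : ∀ i, ‖F i‖ ≤ C) (u : L2 d) :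
    Tendsto (fun i => F i u) l (𝓝 (B u)) := by
  rw [localNormTendsto_iff] at h
  rw [Metric.tendsto_nhds]
  intro ε hε
  obtain ⟨R, hR⟩ := exists_norm_sub_cutoff_lt u (ε := ε / (2 * (|C| + ‖B‖ + 1))) (by positivity)
  set θ := cutoff d R
  filter_upwards [(h θ).eventually (gt_mem_nhds (show 0 < ε / (2 * (‖u‖ + 1)) by positivity))]
    with i hi
  have e1 : F i u - B u = ((F i - B) * mulOp θ.toBCF) u + (F i - B) (u - mulOp θ.toBCF u) := by
    rw [mul_apply_eq_comp, ← map_add]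
    simp
  rw [dist_eq_norm, e1]
  have e2 : ‖F i - B‖ ≤ |C| + ‖B‖ :=
    (norm_sub_le _ _).trans (add_le_add ((hC i).trans (le_abs_self C)) le_rfl)
  calc _ ≤ ‖((F i - B) * mulOp θ.toBCF) u‖ + ‖(F i - B) (u - mulOp θ.toBCF u)‖ := norm_add_le _ _
    _ ≤ ε / (2 * (‖u‖ + 1)) * ‖u‖ + (|C| + ‖B‖) * ‖u - mulOp θ.toBCF u‖ := by
        refine add_le_add (ContinuousLinearMap.le_of_opNorm_le _ hi.le _)
          (ContinuousLinearMap.le_of_opNorm_le _ e2 _)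
    _ ≤ ε / (2 * (‖u‖ + 1)) * (‖u‖ + 1) +
        (|C| + ‖B‖) * (ε / (2 * (|C| + ‖B‖ + 1))) := by
        gcongr
        linarith
    _ < ε / (2 * (‖u‖ + 1)) * (‖u‖ + 1) +
        (|C| + ‖B‖ + 1) * (ε / (2 * (|C| + ‖B‖ + 1))) :=
        add_lt_add_of_le_of_lt le_rfl (mul_lt_mul_of_pos_right (lt_add_one _) (by positivity))
    _ = ε := by field_simp; ring

theorem LocalNormTendsto.unique {ι : Type*} {F : ι → BddOp d} {l : Filter ι} [l.NeBot]
    {B B' : BddOp d} (h : LocalNormTendsto F l B) (h' : LocalNormTendsto F l B') {C : ℝ}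
    (hC : ∀ i, ‖F i‖ ≤ C) : B = B' := by
  ext1 u
  exact tendsto_nhds_unique (h.tendsto_apply hC u) (h'.tendsto_apply hC u)

theorem exists_tendsto_of_norm_le {ι E : Type*} [NormedAddCommGroup E] [NormedSpace ℂ E]
    [FiniteDimensional ℂ E] (κ : Ultrafilter ι) (M : ι → E) {C : ℝ} (hC : ∀ i, ‖M i‖ ≤ C) :
    ∃ m, Tendsto M (κ : Filter ι) (𝓝 m) := by
  have : ProperSpace E := FiniteDimensional.proper ℂ E
  obtain ⟨m, -, hm⟩ := (isCompact_closedBall (0 : E) C).ultrafilter_le_nhds (κ.map M) (by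
    rw [le_principal_iff]
    exact Filter.mem_map.2 (Filter.univ_mem' fun i => by simpa using hC i))
  exact ⟨m, hm⟩

/-- Compressions live in the finite-dimensional space of maps W' → W, where bounded families
converge along ultrafilters. -/
theorem exists_tendsto_compression {ι : Type*} (κ : Ultrafilter ι) (T : ι → BddOp d) {C : ℝ}
    (hC : ∀ i, ‖T i‖ ≤ C) (W W' : Submodule ℂ (L2 d)) [FiniteDimensional ℂ W]
    [FiniteDimensional ℂ W'] :
    ∃ g, Tendsto (fun i => W.starProjection * T i * W'.starProjection) (κ : Filter ι) (𝓝 g) := by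
  set M : ι → W' →L[ℂ] W := fun i => W.orthogonalProjectionOnto ∘L T i ∘L W'.subtypeL with hM
  have hMC : ∀ i, ‖M i‖ ≤ C := fun i => by
    calc ‖M i‖ ≤ ‖W.orthogonalProjectionOnto‖ * (‖T i‖ * ‖W'.subtypeL‖) :=
          (ContinuousLinearMap.opNorm_comp_le _ _).trans (by
            gcongr
            exact ContinuousLinearMap.opNorm_comp_le _ _)
      _ ≤ 1 * (‖T i‖ * 1) := by
          gcongr
          · exact W.orthogonalProjectionOnto_norm_le
          · exact W'.norm_subtypeL_le
      _ ≤ C := by simpa using hC i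
  obtain ⟨m, hm⟩ := exists_tendsto_of_norm_le κ M hMC
  have hcont : Continuous fun N : W' →L[ℂ] W =>
      (W.subtypeL ∘L N ∘L W'.orthogonalProjectionOnto : BddOp d) :=
    continuous_const.clm_comp (continuous_id.clm_comp continuous_const)
  exact ⟨_, (hcont.tendsto m).comp hm⟩

theorem norm_starProjection_le_one (W : Submodule ℂ (L2 d)) [FiniteDimensional ℂ W] :
    ‖W.starProjection‖ ≤ 1 := W.starProjection_norm_le

theorem adjoint_starProjection (W : Submodule ℂ (L2 d)) [FiniteDimensional ℂ W] :
    ContinuousLinearMap.adjoint W.starProjection = W.starProjection :=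
  (Submodule.starProjection_isSymmetric W).isSelfAdjoint.adjoint_eq

/-- W approximates the ranges of τ_x(A) θ(q) and W' those of the adjoints θ̄(q) τ_x(A*). Neither
depends on x, so two-sided compressions approximate the family uniformly. -/
theorem exists_tendsto_translate_mulOp {A : BddOp d} (hA : A ∈ ellipticAlgebra d)
    (κ : Ultrafilter (X d)) (θ : C₀(X d, ℂ)) :
    ∃ g, Tendsto (fun x => translate x A * mulOp θ.toBCF) (κ : Filter (X d)) (𝓝 g) := by
  refine exists_tendsto_of_approx fun ε hε => ?_
  obtain ⟨W, hW, h⟩ := exists_approx_translate_mulOp hA θ (half_pos hε)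
  obtain ⟨W', hW', h'⟩ := exists_approx_mulOp_translate (adjoint_mem_ellipticAlgebra hA) (star θ)
    (half_pos hε)
  refine ⟨_, exists_tendsto_compression κ (fun x => translate x A * mulOp θ.toBCF)
    (C := ‖A‖ * ‖θ‖) (fun x => ?_) W W', fun x => ?_⟩
  · refine (norm_mul_le _ _).trans ?_
    rw [norm_translate]
    gcongr
    exact norm_mulOp_C0_le θ
  · set T := translate x A * mulOp θ.toBCF with hT
    have h1 : ‖T - T * W'.starProjection‖ ≤ ε / 2 := by
      refine le_trans (le_of_eq ?_) (h' x)
      rw [← norm_adjoint, map_sub, adjoint_mul T, adjoint_starProjection, hT, adjoint_mul,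
        adjoint_mulOp, adjoint_translate]
      rfl
    have h2 : T - W.starProjection * T * W'.starProjection =
        (T - W.starProjection * T) + W.starProjection * (T - T * W'.starProjection) := by
      noncomm_ring
    rw [h2]
    refine (norm_add_le _ _).trans ?_
    calc _ ≤ ε / 2 + 1 * (ε / 2) := by
          refine add_le_add (h x) ((norm_mul_le _ _).trans ?_)
          gcongr
          exact norm_starProjection_le_one W
      _ = ε := by ring

/-- Translates of elements of the elliptic algebra have limits along ultrafilters. -/
theorem exists_localNormTendsto_translate {A : BddOp d} (hA : A ∈ ellipticAlgebra d)
    (κ : Ultrafilter (X d)) :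
    ∃ B, LocalNormTendsto (fun x => translate x A) (κ : Filter (X d)) B := by
  have hlim : ∀ u : L2 d, ∃ w, Tendsto (fun x => translate x A u) (κ : Filter (X d)) (𝓝 w) := by
    refine fun u => exists_tendsto_of_approx fun ε hε => ?_
    obtain ⟨R, hR⟩ := exists_norm_sub_cutoff_lt u (ε := ε / (‖A‖ + 1)) (by positivity)
    obtain ⟨g, hg⟩ := exists_tendsto_translate_mulOp hA κ (cutoff d R)
    refine ⟨fun x => (translate x A * mulOp (cutoff d R).toBCF) u,
      ⟨g u, ((ContinuousLinearMap.apply ℂ (L2 d) u).continuous.tendsto g).comp hg⟩, fun x => ?_⟩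
    beta_reduce
    rw [mul_apply_eq_comp, ← map_sub]
    refine ((translate x A).le_opNorm _).trans ?_
    rw [norm_translate]
    calc _ ≤ (‖A‖ + 1) * (ε / (‖A‖ + 1)) := by gcongr; linarith
      _ = ε := by field_simp
  choose f hf using hlim
  -- B is built as the strong limit. Each norm limit of τ_x(A) θ(q) must then equal B θ(q), so one
  -- operator serves every θ.
  set B₀ : L2 d →ₗ[ℂ] L2 d := linearMapOfTendsto f (fun x => (translate x A).toLinearMap)
    (tendsto_pi_nhds.2 hf : Tendsto (fun x u => translate x A u) (κ : Filter (X d)) (𝓝 f)) with hB₀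
  set B : BddOp d := B₀.mkContinuous ‖A‖ fun u => by
    refine le_of_tendsto (hf u).norm (Eventually.of_forall fun x => ?_)
    have := (translate x A).le_opNorm u
    rwa [norm_translate] at this
  refine ⟨B, localNormTendsto_iff.2 fun θ => ?_⟩
  obtain ⟨g, hg⟩ := exists_tendsto_translate_mulOp hA κ θ
  have hBg : B * mulOp θ.toBCF = g := by
    ext1 u
    refine tendsto_nhds_unique (hf (mulOp θ.toBCF u)) ?_
    exact ((ContinuousLinearMap.apply ℂ (L2 d) u).continuous.tendsto g).comp hg
  have := tendsto_iff_norm_sub_tendsto_zero.1 hg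
  refine this.congr fun x => ?_
  rw [sub_mul, hBg]

/-- The seminorms are one-sided, so adjoints do not pass to the limit directly. But A* has its own
limit, which inner products identify. -/
theorem localNormTendsto_adjoint {A : BddOp d} (hA : A ∈ ellipticAlgebra d) (κ : Ultrafilter (X d))
    {B : BddOp d} (hB : LocalNormTendsto (fun x => translate x A) (κ : Filter (X d)) B) :
    LocalNormTendsto (fun x => translate x (ContinuousLinearMap.adjoint A)) (κ : Filter (X d))
      (ContinuousLinearMap.adjoint B) := by
  obtain ⟨B', hB'⟩ := exists_localNormTendsto_translate (adjoint_mem_ellipticAlgebra hA) κ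
  have : B' = ContinuousLinearMap.adjoint B := by
    rw [ContinuousLinearMap.eq_adjoint_iff]
    intro u v
    refine tendsto_nhds_unique ((hB'.tendsto_apply (C := ‖A‖)
      (fun x => by rw [norm_translate, norm_adjoint]) u).inner tendsto_const_nhds) ?_
    refine (tendsto_const_nhds.inner (hB.tendsto_apply (C := ‖A‖)
      (fun x => by rw [norm_translate]) v)).congr fun x => ?_
    rw [← adjoint_translate, ContinuousLinearMap.adjoint_inner_left]
  rwa [← this]

end Limits

/-! ### Fredholm operators have invertible limits. -/

section EssentialSpectrum

variable {d : ℕ}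

theorem SuppIn.inner_eq_zero {u v : L2 d} {S S' : Set (X d)} (hu : SuppIn u S) (hv : SuppIn v S')
    (h : Disjoint S S') : inner ℂ u v = 0 := by
  rw [L2.inner_def]
  refine integral_eq_zero_of_ae ?_
  filter_upwards [hu, hv] with x h1 h2
  by_cases hx : x ∈ S
  · rw [h2 (Set.disjoint_left.1 h hx), inner_zero_right, Pi.zero_apply]
  · rw [h1 hx, inner_zero_left, Pi.zero_apply]

theorem SuppIn.expP {u : L2 d} {S : Set (X d)} (hu : SuppIn u S) (a : X d) :
    SuppIn (expP a u) {x | x + a ∈ S} := by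
  filter_upwards [expP_apply_ae a u, ae_add_right a hu] with x h1 h2 h3
  rw [h1]
  exact h2 h3

theorem suppIn_mulOp_cutoff (R : ℝ) (u : L2 d) :
    SuppIn (mulOp (cutoff d R).toBCF u) (Metric.ball 0 (R + 1)) := by
  have h : SuppIn u Set.univ := Eventually.of_forall fun x hx => absurd trivial hx
  exact (h.mulOp _).mono fun x hx => by simpa using norm_lt_of_cutoff_ne_zero hx.2

/-- The translates of a vector converge weakly to zero at infinity. -/
theorem tendsto_inner_expP_neg (g u : L2 d) :
    Tendsto (fun x : X d => inner ℂ g (expP (-x) u)) (Bornology.cobounded (X d)) (𝓝 0) := by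
  rw [Metric.tendsto_nhds]
  intro ε hε
  obtain ⟨R, hR⟩ := exists_norm_sub_cutoff_lt g (ε := ε / (2 * (‖u‖ + 1))) (by positivity)
  obtain ⟨R', hR'⟩ := exists_norm_sub_cutoff_lt u (ε := ε / (2 * (‖g‖ + 1))) (by positivity)
  set g' := mulOp (cutoff d R).toBCF g
  set u' := mulOp (cutoff d R').toBCF u
  have hg' : ‖g'‖ ≤ ‖g‖ := by
    simpa using ContinuousLinearMap.le_of_opNorm_le _ (norm_cutoff_le R) g
  filter_upwards [tendsto_norm_cobounded_atTop.eventually_ge_atTop (R + 1 + (R' + 1))] with x hx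
  have h0 : inner ℂ g' (expP (-x) u') = 0 := by
    refine (suppIn_mulOp_cutoff R g).inner_eq_zero ((suppIn_mulOp_cutoff R' u).expP (-x)) ?_
    rw [Set.disjoint_left]
    intro y hy hy'
    have h1 : ‖y‖ < R + 1 := by simpa using hy
    have h2 : ‖y + -x‖ < R' + 1 := by simpa using hy'
    have h3 : ‖x‖ ≤ ‖y‖ + ‖y + -x‖ := by
      calc ‖x‖ = ‖y - (y + -x)‖ := by congr 1; abel
        _ ≤ _ := norm_sub_le _ _
    linarith
  have h1 : inner ℂ g (expP (-x) u) =
      inner ℂ (g - g') (expP (-x) u) + inner ℂ g' (expP (-x) (u - u')) := by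
    rw [map_sub, inner_sub_left, inner_sub_right, h0]
    ring
  rw [dist_zero_right, h1]
  calc _ ≤ ‖inner ℂ (g - g') (expP (-x) u)‖ + ‖inner ℂ g' (expP (-x) (u - u'))‖ := norm_add_le _ _
    _ ≤ ‖g - g'‖ * ‖u‖ + ‖g‖ * ‖u - u'‖ := by
        refine add_le_add ((norm_inner_le_norm _ _).trans_eq (by rw [norm_expP_apply]))
          ((norm_inner_le_norm _ _).trans ?_)
        rw [norm_expP_apply]
        gcongr
    _ ≤ ε / (2 * (‖u‖ + 1)) * ‖u‖ + ‖g‖ * (ε / (2 * (‖g‖ + 1))) := by gcongr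
    _ < ε / (2 * (‖u‖ + 1)) * (‖u‖ + 1) + (‖g‖ + 1) * (ε / (2 * (‖g‖ + 1))) :=
        add_lt_add (mul_lt_mul_of_pos_left (lt_add_one _) (by positivity))
          (mul_lt_mul_of_pos_right (lt_add_one _) (by positivity))
    _ = ε := by field_simp; ring

/-- In an orthonormal basis of the range, F is a finite sum of inner products with fixed vectors, so
weak convergence becomes norm convergence. -/
theorem tendsto_finiteRange_expP_neg {F : BddOp d} (hF : F.toLinearMap.HasFiniteRange) (u : L2 d) :
    Tendsto (fun x : X d => F (expP (-x) u)) (Bornology.cobounded (X d)) (𝓝 0) := by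
  have : FiniteDimensional ℂ F.range := Module.Finite.of_fg hF.fg_range
  set b := stdOrthonormalBasis ℂ F.range
  have h : ∀ w, F w = ∑ i, inner ℂ (ContinuousLinearMap.adjoint F (b i : L2 d)) w • (b i : L2 d) :=
    fun w => by
    have h1 := b.sum_repr' ⟨F w, LinearMap.mem_range_self F.toLinearMap w⟩
    have h2 := congrArg (Subtype.val) h1
    rw [Submodule.coe_sum] at h2
    refine Eq.trans h2.symm (Eq.trans ?_ rfl)
    refine Finset.sum_congr rfl fun i _ => ?_
    rw [ContinuousLinearMap.adjoint_inner_left]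
    rfl
  have h2 : Tendsto (fun x : X d => ∑ i, inner ℂ (ContinuousLinearMap.adjoint F (b i : L2 d))
      (expP (-x) u) • (b i : L2 d)) (Bornology.cobounded (X d)) (𝓝 (∑ i, (0 : ℂ) • (b i : L2 d))) :=
    tendsto_finsetSum _ fun i _ => (tendsto_inner_expP_neg _ u).smul_const _
  simp only [zero_smul, Finset.sum_const_zero] at h2
  exact h2.congr fun x => (h _).symm

theorem translate_apply_expP (x : X d) (T : BddOp d) (u : L2 d) :
    translate x T (expP x u) = expP x (T u) := by
  rw [translate, mul_apply_eq_comp, mul_apply_eq_comp, ← mul_apply_eq_comp (expP (-x)),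
    expP_neg_mul, one_apply_eq_self]

theorem translate_sub_smul (x : X d) (A : BddOp d) (z : ℂ) :
    translate x (A - z • 1) = translate x A - z • 1 := by
  rw [translate_sub]
  congr 1
  rw [translate, mul_smul_comm, mul_one, smul_mul_assoc, expP_mul_neg]

/-- Limits at infinity of an operator which is bounded below up to finite rank are bounded
below. -/
theorem exists_bounded_below_of_tendsto {T S : BddOp d} (hT : IsBoundedBelowModFiniteRank T)
    {κ : Ultrafilter (X d)} (hκ : κ ∈ ultrafiltersAtInfinity d)
    (h : ∀ u, Tendsto (fun x => translate x T u) (κ : Filter (X d)) (𝓝 (S u))) :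
    ∃ C : ℝ, 0 ≤ C ∧ ∀ u, ‖u‖ ≤ C * ‖S u‖ := by
  obtain ⟨C, F, hC, hF, hCF⟩ := hT
  refine ⟨C, hC, fun u => ?_⟩
  have h1 : Tendsto (fun x => C * (‖translate x T u‖ + ‖F (expP (-x) u)‖)) (κ : Filter (X d))
      (𝓝 (C * (‖S u‖ + ‖(0 : L2 d)‖))) :=
    ((h u).norm.add ((tendsto_finiteRange_expP_neg hF u).mono_left hκ).norm).const_mul C
  rw [norm_zero, add_zero] at h1
  refine ge_of_tendsto h1 (Eventually.of_forall fun x => ?_)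
  have h2 := hCF (expP (-x) u)
  rw [norm_expP_apply] at h2
  refine h2.trans_eq ?_
  rw [translate, mul_apply_eq_comp, mul_apply_eq_comp, norm_expP_apply]

theorem adjoint_sub_smul_one (A : BddOp d) (z : ℂ) :
    ContinuousLinearMap.adjoint (A - z • (1 : BddOp d)) =
      ContinuousLinearMap.adjoint A - (starRingEnd ℂ z) • 1 := by
  rw [map_sub, map_smulₛₗ]
  congr 2
  exact ContinuousLinearMap.adjoint_id

theorem LocalNormTendsto.tendsto_translate_sub_smul_apply {A B : BddOp d} {l : Filter (X d)}
    (h : LocalNormTendsto (fun x => translate x A) l B) (z : ℂ) (u : L2 d) :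
    Tendsto (fun x => translate x (A - z • 1) u) l (𝓝 ((B - z • 1) u)) := by
  simp_rw [translate_sub_smul, sub_apply]
  exact (h.tendsto_apply (C := ‖A‖) (fun x => by rw [norm_translate]) u).sub_const _

theorem isUnit_sub_of_isFredholm {A B : BddOp d} (hA : A ∈ ellipticAlgebra d)
    {κ : Ultrafilter (X d)} (hκ : κ ∈ ultrafiltersAtInfinity d)
    (hB : LocalNormTendsto (fun x => translate x A) (κ : Filter (X d)) B) {z : ℂ}
    (hz : ContinuousLinearMap.IsFredholm (A - z • (1 : BddOp d))) :
    IsUnit (B - z • (1 : BddOp d)) := by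
  obtain ⟨h1, h2⟩ := IsFredholm.isBoundedBelowModFiniteRank hz
  obtain ⟨C, hC, hBC⟩ := exists_bounded_below_of_tendsto h1 hκ
    (hB.tendsto_translate_sub_smul_apply z)
  rw [adjoint_sub_smul_one] at h2
  obtain ⟨C', hC', hBC'⟩ := exists_bounded_below_of_tendsto h2 hκ
    ((localNormTendsto_adjoint hA κ hB).tendsto_translate_sub_smul_apply _)
  refine isUnit_of_bounded_below (C := max C C') (hC.trans (le_max_left _ _))
    (fun u => (hBC u).trans ?_) fun u => ?_
  · gcongr
    exact le_max_left _ _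
  · rw [adjoint_sub_smul_one]
    refine (hBC' u).trans ?_
    gcongr
    exact le_max_right _ _

/-! ### From failure of Fredholmness to a non-invertible limit. -/

/-- Operators of the elliptic algebra which are bounded below far away, up to a nonzero scalar, are
bounded below up to finite rank. -/
theorem isBoundedBelowModFiniteRank_of_far {A : BddOp d} (hA : A ∈ ellipticAlgebra d) {z : ℂ}
    (hz : z ≠ 0) {R δ : ℝ} (hδ : 0 < δ)
    (h : ∀ u : L2 d, SuppIn u {x | R ≤ ‖x‖} → δ * ‖u‖ ≤ ‖(A - z • (1 : BddOp d)) u‖) :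
    IsBoundedBelowModFiniteRank (A - z • (1 : BddOp d)) := by
  set T := A - z • (1 : BddOp d) with hT
  set χ := mulOp (cutoff d R).toBCF with hχ
  have hz' : 0 < ‖z‖ := norm_pos_iff.2 hz
  have hχ1 : ∀ w, ‖χ w‖ ≤ ‖w‖ := fun w => by
    simpa using ContinuousLinearMap.le_of_opNorm_le _ (norm_cutoff_le R) w
  have h1 : ∀ u, ‖u‖ ≤ δ⁻¹ * ‖T u‖ + (1 + δ⁻¹ * ‖T‖) * ‖χ u‖ := fun u => by
    have hsupp : SuppIn (u - χ u) {x | R ≤ ‖x‖} := by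
      have hu : SuppIn u Set.univ := Eventually.of_forall fun x hx => absurd trivial hx
      have := hu.mulOp (1 - (cutoff d R).toBCF)
      rw [mulOp_sub, mulOp_one, sub_apply, one_apply_eq_self] at this
      refine this.mono fun x hx => ?_
      by_contra hlt
      apply hx.2
      rw [BoundedContinuousFunction.sub_apply, cutoff_eq_one (not_le.1 hlt).le]
      simp
    have h2 := h _ hsupp
    have h3 : ‖u - χ u‖ ≤ δ⁻¹ * (‖T u‖ + ‖T‖ * ‖χ u‖) := by
      rw [le_inv_mul_iff₀ hδ]
      refine h2.trans ?_
      rw [map_sub]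
      exact (norm_sub_le _ _).trans (add_le_add le_rfl (T.le_opNorm _))
    calc ‖u‖ = ‖(u - χ u) + χ u‖ := by rw [sub_add_cancel]
      _ ≤ ‖u - χ u‖ + ‖χ u‖ := norm_add_le _ _
      _ ≤ δ⁻¹ * (‖T u‖ + ‖T‖ * ‖χ u‖) + ‖χ u‖ := by gcongr
      _ = _ := by ring
  have h2 : ∀ u, ‖χ u‖ ≤ ‖z‖⁻¹ * (‖T u‖ + ‖(χ * A) u‖) := fun u => by
    rw [le_inv_mul_iff₀ hz', ← norm_smul]
    -- Here z ≠ 0 matters: it bounds the part of u near the origin by T u and the compact term χ A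
    -- u.
    have : z • χ u = (χ * A) u - χ (T u) := by
      simp [hT]
    rw [this, add_comm]
    exact (norm_sub_le _ _).trans (add_le_add le_rfl (hχ1 _))
  set c := 1 + δ⁻¹ * ‖T‖
  refine isBoundedBelowModFiniteRank_of_approx (K := χ * A) (C := δ⁻¹ + c * ‖z‖⁻¹) (by positivity)
    (fun u => ?_) fun ε hε => ?_
  · calc ‖u‖ ≤ δ⁻¹ * ‖T u‖ + c * ‖χ u‖ := h1 u
      _ ≤ δ⁻¹ * (‖T u‖ + ‖(χ * A) u‖) + c * (‖z‖⁻¹ * (‖T u‖ + ‖(χ * A) u‖)) := by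
          gcongr
          · exact le_add_of_nonneg_right (norm_nonneg _)
          · exact h2 u
      _ = _ := by ring
  · obtain ⟨W, hW, hWε⟩ := exists_approx_mulOp_translate hA (cutoff d R) hε
    have h3 := hWε 0
    have h4 : translate 0 A = A := by rw [translate, neg_zero, expP_zero, one_mul, mul_one]
    rw [h4] at h3
    refine ⟨W.starProjection * (χ * A), ?_, h3⟩
    have h5 : W.starProjection.toLinearMap.HasFiniteRange := by
      have : W.starProjection.toLinearMap =
        W.subtype ∘ₗ W.orthogonalProjectionOnto.toLinearMap := rfl
      rw [this]
      exact LinearMap.HasFiniteRange.of_finite_dom.comp_right _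
    exact h5.comp_right _

/-- If there are approximate kernel vectors arbitrarily far away, then some limit operator is not
bounded below. -/
theorem exists_ultrafilter_of_far {A : BddOp d} (hA : A ∈ ellipticAlgebra d) {z : ℂ}
    (h : ∀ R δ : ℝ, 0 < δ → ∃ u : L2 d, SuppIn u {x | R ≤ ‖x‖} ∧
      ‖(A - z • (1 : BddOp d)) u‖ < δ * ‖u‖) :
    ∃ κ ∈ ultrafiltersAtInfinity d, ∀ B,
      LocalNormTendsto (fun x => translate x A) (κ : Filter (X d)) B →
        ∀ ε > 0, ∃ w : L2 d, w ≠ 0 ∧ ‖(B - z • (1 : BddOp d)) w‖ ≤ ε * ‖w‖ := by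
  set T := A - z • (1 : BddOp d) with hT
  have hTQ : QContinuous T := by
    refine hA.2.2.congr fun a => ?_
    rw [hT, mul_sub, sub_mul, mul_smul_comm, mul_one, smul_mul_assoc, expQ_neg_mul,
      sub_sub_sub_cancel_right]
  set c : ℝ := 4 ^ d with hc
  have hcpos : 0 < c := by positivity
  have hc1 : 1 ≤ c := one_le_pow₀ (by norm_num)
  -- The factor 2 makes the precisions tend to 0 even when c = 1, that is in dimension 0.
  set δ : ℕ → ℝ := fun k => ((2 * c)⁻¹) ^ k with hδ
  have hδpos : ∀ k, 0 < δ k := fun k => by positivity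
  obtain ⟨R, hR⟩ := hTQ.exists_nested_localization δ hδpos fun k => by
    rw [hδ]
    simp only
    rw [pow_succ', ← mul_assoc]
    refine mul_le_of_le_one_left (by positivity) ?_
    rw [mul_inv, mul_comm (2⁻¹ : ℝ), ← mul_assoc, mul_inv_cancel₀ hcpos.ne']
    norm_num
  have hstart : ∀ n : ℕ, ∃ (S : Set (X d)) (u : L2 d), Bornology.IsBounded S ∧
      (∀ x ∈ S, (n : ℝ) ≤ ‖x‖) ∧ SuppIn u S ∧ u ≠ 0 ∧ ‖T u‖ ≤ δ n * ‖u‖ := fun n => by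
    obtain ⟨u, hu, hTu⟩ := h n (δ n) (hδpos n)
    -- Localization requires bounded support. The strict inequality for u survives truncation at a
    -- large radius.
    have hlim : Tendsto (fun r : ℝ => mulOp (cutoff d r).toBCF u) atTop (𝓝 u) := by
      rw [tendsto_iff_norm_sub_tendsto_zero]
      refine (tendsto_cutoff_apply u).congr fun r => ?_
      rw [mulOp_sub, mulOp_one, sub_apply, one_apply_eq_self, norm_sub_rev]
    have hu0 : u ≠ 0 := by
      rintro rfl
      simp at hTu
    have e1 : ∀ᶠ r in atTop, ‖T (mulOp (cutoff d r).toBCF u)‖ <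
        δ n * ‖mulOp (cutoff d r).toBCF u‖ :=
      ((T.continuous.tendsto u).comp hlim).norm.eventually_lt (hlim.norm.const_mul _) hTu
    have e2 : ∀ᶠ r in atTop, mulOp (cutoff d r).toBCF u ≠ 0 := hlim.eventually_ne hu0
    obtain ⟨r, h1, h2⟩ := (e1.and e2).exists
    refine ⟨{x | (n : ℝ) ≤ ‖x‖} ∩ {x | (cutoff d r).toBCF x ≠ 0}, _, ?_, fun x hx => hx.1,
      hu.mulOp _, h2, h1.le⟩
    refine (Metric.isBounded_ball (x := (0 : X d)) (r := r + 1)).subset fun x hx => ?_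
    simpa using norm_lt_of_cutoff_ne_zero hx.2
  choose S u hS hSn hu hu0 hTu using hstart
  choose x hx hloc using fun n => hR n (S n) (u n) (hS n) (hu n) (hu0 n) (hTu n)
  have hxtend : Tendsto x atTop (Bornology.cobounded (X d)) := by
    rw [← tendsto_norm_atTop_iff_cobounded]
    exact tendsto_atTop_mono (fun n => hSn n _ (hx n)) tendsto_natCast_atTop_atTop
  -- The ultrafilter follows the centres x n. For every k, all n ≥ k carry a vector of precision k
  -- within distance R k of x n, so this one ultrafilter works for every ε.
  refine ⟨(hyperfilter ℕ).map x, ?_, fun B hB ε hε => ?_⟩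
  · exact hxtend.mono_left Nat.hyperfilter_le_atTop
  · obtain ⟨k, hk⟩ := exists_pow_lt_of_lt_one (show 0 < ε / (c + 1) by positivity)
      (show (2 * c)⁻¹ < 1 from inv_lt_one_of_one_lt₀ (by linarith))
    have h1 := (localNormTendsto_iff.1 hB (cutoff d (R k))).eventually (gt_mem_nhds (hδpos k))
    have h2 : ∀ᶠ n in (hyperfilter ℕ : Filter ℕ),
        ‖(translate (x n) A - B) * mulOp (cutoff d (R k)).toBCF‖ < δ k := h1
    have h3 : ∀ᶠ n in (hyperfilter ℕ : Filter ℕ), k ≤ n :=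
      (eventually_ge_atTop k).filter_mono Nat.hyperfilter_le_atTop
    obtain ⟨n, hn, hkn⟩ := (h2.and h3).exists
    obtain ⟨v, hv0, hvS, hTv⟩ := hloc n k hkn
    set w := expP (x n) v with hw
    have hwnorm : ‖w‖ = ‖v‖ := norm_expP_apply _ _
    have hw0 : w ≠ 0 := by
      rw [← norm_ne_zero_iff, hwnorm, norm_ne_zero_iff]
      exact hv0
    have hwS : SuppIn w {y | ‖y‖ ≤ R k} := (hvS.expP (x n)).mono fun y hy => by
      simpa [dist_eq_norm] using hy
    have hθw : mulOp (cutoff d (R k)).toBCF w = w := by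
      refine Lp.ext ?_
      filter_upwards [mulOp_apply_ae (cutoff d (R k)).toBCF w, hwS] with y h1 h2
      rw [h1]
      by_cases hy : ‖y‖ ≤ R k
      · rw [cutoff_eq_one hy, one_mul]
      · rw [h2 hy, mul_zero]
    refine ⟨w, hw0, ?_⟩
    have e1 : (B - z • (1 : BddOp d)) w = translate (x n) T w -
        ((translate (x n) A - B) * mulOp (cutoff d (R k)).toBCF) w := by
      rw [mul_apply_eq_comp, hθw, hT, translate_sub_smul]
      simp only [sub_apply]
      abel
    rw [e1]
    calc _ ≤ ‖translate (x n) T w‖ +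
          ‖((translate (x n) A - B) * mulOp (cutoff d (R k)).toBCF) w‖ := norm_sub_le _ _
      _ ≤ c * δ k * ‖w‖ + δ k * ‖w‖ := by
          refine add_le_add ?_ (ContinuousLinearMap.le_of_opNorm_le _ hn.le _)
          rw [hw, translate_apply_expP, norm_expP_apply, norm_expP_apply]
          exact hTv
      _ = (c + 1) * δ k * ‖w‖ := by ring
      _ ≤ (c + 1) * (ε / (c + 1)) * ‖w‖ := by gcongr
      _ = ε * ‖w‖ := by rw [mul_div_cancel₀ _ (by positivity)]

theorem not_isUnit_of_almost_kernel {S : BddOp d}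
    (h : ∀ ε > 0, ∃ w : L2 d, w ≠ 0 ∧ ‖S w‖ ≤ ε * ‖w‖) : ¬ IsUnit S := by
  rintro ⟨U, rfl⟩
  obtain ⟨w, hw, hSw⟩ := h (1 / (2 * (‖(↑U⁻¹ : BddOp d)‖ + 1))) (by positivity)
  have hw' : 0 < ‖w‖ := norm_pos_iff.2 hw
  have h1 : ‖w‖ ≤ ‖(↑U⁻¹ : BddOp d)‖ * (1 / (2 * (‖(↑U⁻¹ : BddOp d)‖ + 1)) * ‖w‖) := by
    calc ‖w‖ = ‖((↑U⁻¹ : BddOp d) * (↑U : BddOp d)) w‖ := by rw [Units.inv_mul, one_apply_eq_self]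
      _ ≤ ‖(↑U⁻¹ : BddOp d)‖ * ‖(↑U : BddOp d) w‖ := by
          rw [mul_apply_eq_comp]
          exact ContinuousLinearMap.le_opNorm _ _
      _ ≤ _ := by gcongr
  have h2 : ‖(↑U⁻¹ : BddOp d)‖ * (1 / (2 * (‖(↑U⁻¹ : BddOp d)‖ + 1)) * ‖w‖) ≤ ‖w‖ / 2 := by
    calc _ ≤ (‖(↑U⁻¹ : BddOp d)‖ + 1) * (1 / (2 * (‖(↑U⁻¹ : BddOp d)‖ + 1)) * ‖w‖) := by
          gcongr; linarith
      _ = ‖w‖ / 2 := by field_simp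
  linarith

theorem isUnit_adjoint {S : BddOp d} (h : IsUnit S) : IsUnit (ContinuousLinearMap.adjoint S) := by
  rw [← ContinuousLinearMap.star_eq_adjoint]
  exact h.star

/-- Far approximate kernel vectors may belong to A - z or only to its adjoint. In the second case
the limit of the adjoints is not invertible, hence neither is the limit itself. -/
theorem not_isUnit_of_not_isFredholm {A : BddOp d} (hA : A ∈ ellipticAlgebra d) {z : ℂ} (hz : z ≠ 0)
    (hF : ¬ ContinuousLinearMap.IsFredholm (A - z • (1 : BddOp d))) :
    ∃ κ ∈ ultrafiltersAtInfinity d, ∀ B,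
      LocalNormTendsto (fun x => translate x A) (κ : Filter (X d)) B →
        ¬ IsUnit (B - z • (1 : BddOp d)) := by
  by_cases h : ∀ R δ : ℝ, 0 < δ → ∃ u : L2 d, SuppIn u {x | R ≤ ‖x‖} ∧
      ‖(A - z • (1 : BddOp d)) u‖ < δ * ‖u‖
  · obtain ⟨κ, hκ, hB⟩ := exists_ultrafilter_of_far hA h
    exact ⟨κ, hκ, fun B hκB => not_isUnit_of_almost_kernel (hB B hκB)⟩
  by_cases h' : ∀ R δ : ℝ, 0 < δ → ∃ u : L2 d, SuppIn u {x | R ≤ ‖x‖} ∧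
      ‖(ContinuousLinearMap.adjoint A - (starRingEnd ℂ z) • (1 : BddOp d)) u‖ < δ * ‖u‖
  · obtain ⟨κ, hκ, hB⟩ := exists_ultrafilter_of_far (adjoint_mem_ellipticAlgebra hA) h'
    refine ⟨κ, hκ, fun B hκB hunit => ?_⟩
    refine not_isUnit_of_almost_kernel (hB _ (localNormTendsto_adjoint hA κ hκB)) ?_
    rw [← adjoint_sub_smul_one]
    exact isUnit_adjoint hunit
  push Not at h h'
  obtain ⟨R, δ, hδ, h⟩ := h
  obtain ⟨R', δ', hδ', h'⟩ := h'
  refine absurd (isFredholm_of_isBoundedBelowModFiniteRank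
    (isBoundedBelowModFiniteRank_of_far hA hz hδ h) ?_) hF
  rw [adjoint_sub_smul_one]
  exact isBoundedBelowModFiniteRank_of_far (adjoint_mem_ellipticAlgebra hA)
    ((map_ne_zero _).2 hz) hδ' h'

/-! ### The point zero of the spectrum, and dimension zero. -/

/-- Translation operators are uniformly far from the identity. -/
theorem one_le_norm_expP_sub_one [Nontrivial (L2 d)] {a : X d} (ha : a ≠ 0) :
    1 ≤ ‖expP a - 1‖ := by
  -- With b·a = π, conjugation by `expQ b` changes the sign of `expP a`. So ‖`expP a` + 1‖ ≤ ‖`expP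
  -- a` - 1‖, and the two norms add up to at least 2.
  set b : X d := (Real.pi / ‖a‖ ^ 2) • a with hb
  have hab : inner ℝ b a = Real.pi := by
    rw [hb, real_inner_smul_left, real_inner_self_eq_norm_sq]
    exact div_mul_cancel₀ _ (by simpa using ha)
  have h1 : expQ (-b) * expP a * expQ b = -expP a := by
    rw [mul_assoc, expP_mul_expQ, hab, mul_comm Complex.I, Complex.exp_pi_mul_I, neg_one_smul,
      mul_neg, ← mul_assoc, expQ_neg_mul, one_mul]
  have h2 : expP a + 1 = -(expQ (-b) * (expP a - 1) * expQ b) := by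
    rw [mul_sub, sub_mul, h1, mul_one, expQ_neg_mul]
    abel
  have h3 : ‖expP a + 1‖ ≤ ‖expP a - 1‖ := by
    rw [h2, norm_neg]
    calc _ ≤ ‖expQ (-b)‖ * ‖expP a - 1‖ * ‖expQ b‖ :=
          (norm_mul_le _ _).trans (by gcongr; exact norm_mul_le _ _)
      _ ≤ 1 * ‖expP a - 1‖ * 1 := by
          gcongr
          · exact norm_expQ_le _
          · exact norm_expQ_le _
      _ = _ := by ring
  have h4 : (2 : ℝ) = ‖(2 : ℂ) • (1 : BddOp d)‖ := by
    rw [norm_smul, norm_one]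
    simp
  have h5 : (2 : ℂ) • (1 : BddOp d) = (expP a + 1) - (expP a - 1) := by
    rw [two_smul]; abel
  have h6 := norm_sub_le (expP a + 1) (expP a - 1)
  rw [← h5, ← h4] at h6
  linarith

theorem not_isUnit_limit {A B : BddOp d} [Nontrivial (L2 d)] [Nontrivial (X d)]
    (hA : A ∈ ellipticAlgebra d) {κ : Ultrafilter (X d)}
    (hB : LocalNormTendsto (fun x => translate x A) (κ : Filter (X d)) B) : ¬ IsUnit B := by
  rintro ⟨U, rfl⟩
  set c := ‖(↑U⁻¹ : BddOp d)‖ + 1 with hc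
  have hcpos : 0 < c := by positivity
  obtain ⟨r, hr, h⟩ := Metric.eventually_nhds_iff.1
    (hA.1.eventually (gt_mem_nhds (show 0 < 1 / (2 * c) by positivity)))
  obtain ⟨a, ha0, ha⟩ : ∃ a : X d, a ≠ 0 ∧ ‖a‖ < r := by
    obtain ⟨a, ha⟩ := exists_ne (0 : X d)
    refine ⟨(r / (2 * ‖a‖)) • a, smul_ne_zero (by positivity) ha, ?_⟩
    rw [norm_smul, Real.norm_of_nonneg (by positivity)]
    have : 0 < ‖a‖ := norm_pos_iff.2 ha
    field_simp
    linarith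
  have h1 : ‖(expP a - 1) * A‖ < 1 / (2 * c) := h (by rwa [dist_zero_right])
  -- Translation leaves ‖(`expP a` - 1) A‖ unchanged, and the bound survives strong limits.
  have h2 : ‖(expP a - 1) * (↑U : BddOp d)‖ ≤ 1 / (2 * c) := by
    refine ContinuousLinearMap.opNorm_le_bound _ (by positivity) fun u => ?_
    have h3 := (((expP a - 1).continuous.tendsto _).comp
      (hB.tendsto_apply (C := ‖A‖) (fun x => by rw [norm_translate]) u)).norm
    refine le_of_tendsto h3 (Eventually.of_forall fun x => ?_)
    have h4 : (expP a - 1) * translate x A = translate x ((expP a - 1) * A) := by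
      rw [translate_mul, translate_sub, translate_expP, translate_one]
    rw [Function.comp_apply, ← mul_apply_eq_comp, h4]
    refine ContinuousLinearMap.le_of_opNorm_le _ ?_ u
    rw [norm_translate]
    exact h1.le
  have h3 : ‖expP a - 1‖ ≤ 1 / 2 := by
    calc ‖expP a - 1‖ = ‖(expP a - 1) * (↑U : BddOp d) * (↑U⁻¹ : BddOp d)‖ := by
          rw [mul_assoc, Units.mul_inv, mul_one]
      _ ≤ 1 / (2 * c) * c := (norm_mul_le _ _).trans (by gcongr; linarith)
      _ = 1 / 2 := by field_simp
  linarith [one_le_norm_expP_sub_one (d := d) ha0]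

/-- On a one-point space every function is constant. -/
theorem finiteDimensional_of_subsingleton [Subsingleton (X d)] : FiniteDimensional ℂ (L2 d) := by
  have : CompactSpace (X d) := inferInstance
  refine Module.Finite.of_surjective (Lp.constL 2 (volume : Measure (X d)) ℂ (E := ℂ)).toLinearMap
    fun u => ⟨u 0, Lp.ext ?_⟩
  filter_upwards [Lp.coeFn_const (μ := (volume : Measure (X d))) 2 (u 0)] with x hx
  exact hx.trans (by rw [Function.const_apply, Subsingleton.elim x 0])

theorem exists_not_isUnit_of_not_isFredholm {A : BddOp d} (hA : A ∈ ellipticAlgebra d) {z : ℂ}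
    (hF : ¬ ContinuousLinearMap.IsFredholm (A - z • (1 : BddOp d))) :
    ∃ κ ∈ ultrafiltersAtInfinity d, ∀ B,
      LocalNormTendsto (fun x => translate x A) (κ : Filter (X d)) B →
        ¬ IsUnit (B - z • (1 : BddOp d)) := by
  by_cases hz : z = 0
  · have hX : Nontrivial (X d) := by
      by_contra h
      rw [not_nontrivial_iff_subsingleton] at h
      have := finiteDimensional_of_subsingleton (d := d)
      exact hF (isFredholm_of_finiteDimensional _)
    have hL : Nontrivial (L2 d) := by
      by_contra h
      rw [not_nontrivial_iff_subsingleton] at h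
      exact hF (isFredholm_of_finiteDimensional _)
    have hne : (Bornology.cobounded (X d)).NeBot := NormedSpace.cobounded_neBot ℝ (X d)
    refine ⟨Ultrafilter.of (Bornology.cobounded (X d)), Ultrafilter.of_le _, fun B hB => ?_⟩
    rw [hz, zero_smul, sub_zero]
    exact not_isUnit_limit hA hB
  · exact not_isUnit_of_not_isFredholm hA hz hF

theorem mem_spectrum_iff_not_isUnit_sub {B : BddOp d} {z : ℂ} :
    z ∈ spectrum ℂ B ↔ ¬ IsUnit (B - z • (1 : BddOp d)) := by
  rw [spectrum.mem_iff, Algebra.algebraMap_eq_smul_one, IsUnit.sub_iff]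

end EssentialSpectrum

end EllipticAlgebra

end

theorem theorem1p1 (d : ℕ) (A : EllipticAlgebra.BddOp d)
    (hA : A ∈ EllipticAlgebra.ellipticAlgebra d) :
    ∃ Aloc : EllipticAlgebra.ultrafiltersAtInfinity d → EllipticAlgebra.BddOp d,
      (∀ κ : EllipticAlgebra.ultrafiltersAtInfinity d,
        EllipticAlgebra.LocalNormTendsto (fun x => EllipticAlgebra.translate x A)
          (κ.1 : Filter (EllipticAlgebra.X d)) (Aloc κ) ∧
        ∀ B : EllipticAlgebra.BddOp d,
          EllipticAlgebra.LocalNormTendsto (fun x => EllipticAlgebra.translate x A)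
            (κ.1 : Filter (EllipticAlgebra.X d)) B → B = Aloc κ) ∧
      EllipticAlgebra.essSpectrum A =
        ⋃ κ : EllipticAlgebra.ultrafiltersAtInfinity d, spectrum ℂ (Aloc κ) := by
  choose Aloc hAloc using fun κ : EllipticAlgebra.ultrafiltersAtInfinity d =>
    EllipticAlgebra.exists_localNormTendsto_translate hA κ.1
  refine ⟨Aloc, fun κ => ⟨hAloc κ, fun B hB => hB.unique (hAloc κ) (C := ‖A‖) fun x => by
    rw [EllipticAlgebra.norm_translate]⟩, ?_⟩
  ext z
  rw [Set.mem_iUnion]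
  constructor
  · intro hz
    obtain ⟨κ, hκ, h⟩ := EllipticAlgebra.exists_not_isUnit_of_not_isFredholm hA hz
    exact ⟨⟨κ, hκ⟩, EllipticAlgebra.mem_spectrum_iff_not_isUnit_sub.2 (h _ (hAloc ⟨κ, hκ⟩))⟩
  · rintro ⟨κ, hκ⟩ hz
    exact EllipticAlgebra.mem_spectrum_iff_not_isUnit_sub.1 hκ
      (EllipticAlgebra.isUnit_sub_of_isFredholm hA κ.2 (hAloc κ) hz)
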